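/- Work over $\mathbb{C}$ with classical projective varieties (Zariski closed subsets of products of projective spaces); an isomorphism is a bijection which, in both directions, is Zariski-locally given by multihomogeneous polynomials of equal multidegree without common zeros. Let $Seg(1,3)\subset\mathbb{P}^7=\mathbb{P}((\mathbb{C}^2)^{\otimes 3})$ be the image of the Segre embedding of $\mathbb{P}^1\times\mathbb{P}^1\times\mathbb{P}^1$. Let the Togliatti surface $S_6\subset\mathbb{P}^6$ be the (closure of the) image of the rational map $\mathbb{P}^2\dashrightarrow\mathbb{P}^6$, $$(x_0:x_1:x_2)\mapsto(x_0x_1x_2:\ x_0^2x_1:\ x_0^2x_2:\ x_1^2x_2:\ x_1x_2^2:\ x_0x_1^2:\ x_0x_2^2).$$ Proposition. (1) For a general hyperplane $H\subset\mathbb{P}^7$, i.e. for all $H$ in some non-empty Zariski open subset of the dual projective space $\mathbb{P}^{7\vee}$, the hyperplane $H$ contains the embedded tangent space $T_xSeg(1,3)$ at no point $x\in Seg(1,3)$ (so $H$ meets $Seg(1,3)$ transversally), and $H\cap Seg(1,3)$ is isomorphic to $S_6$. (2) $S_6$ is the del Pezzo surface of degree $6$: for any three non-collinear points $p_1,p_2,p_3\in\mathbb{P}^2$,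 it is isomorphic to the blow-up of $\mathbb{P}^2$ at $p_1,p_2,p_3$, that is, to the closure in $\mathbb{P}^2\times(\mathbb{P}^{2\vee})^3$ of the graph of $x\mapsto(\overline{xp_1},\overline{xp_2},\overline{xp_3})$, where $\overline{xp_i}$ is the line joining $x$ and $p_i$, defined for $x\ne p_1,p_2,p_3$. -/

import Mathlib

namespace Togliatti

open scoped LinearAlgebra.Projectivization

noncomputable section

/-! ### Closed subsets of products of complex projective spaces, and their isomorphisms -/

/-- The product, over `i`, of the complex projective spaces with homogeneous coordinates
indexed by `σ i`. -/
abbrev MultiProj {ι : Type} (σ : ι → Type) : Type :=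
  ∀ i, ℙ ℂ (σ i → ℂ)

/-- The complex projective space with homogeneous coordinates indexed by `σ`, as a product with
one factor. -/
abbrev ProjSpace (σ : Type) : Type :=
  MultiProj (fun _ : Unit => σ)

/-- Polynomials in the homogeneous coordinates of all the factors. -/
abbrev CoordRing {ι : Type} (σ : ι → Type) : Type :=
  MvPolynomial (Σ i, σ i) ℂ

/-- `F` is multihomogeneous of multidegree `d`: it is homogeneous of degree `d i` in the
coordinates of the `i`-th factor, for every `i`. -/
def IsMultihomogeneous {ι : Type} {σ : ι → Type} (F : CoordRing σ) (d : ι →₀ ℕ) : Prop :=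
  MvPolynomial.IsWeightedHomogeneous (fun v : Σ i, σ i => Finsupp.single v.1 1) F d

/-- The value of a polynomial at chosen homogeneous coordinates of a point. For multihomogeneous
`F`, another choice multiplies it by a nonzero scalar depending only on the multidegree. -/
def evalRep {ι : Type} {σ : ι → Type} (x : MultiProj σ) (F : CoordRing σ) : ℂ :=
  MvPolynomial.eval (fun v : Σ i, σ i => (x v.1).rep v.2) F

/-- Zariski closed sets: common zeros of sets of multihomogeneous polynomials. -/
def IsZariskiClosed {ι : Type} {σ : ι → Type} (Z : Set (MultiProj σ)) : Prop :=
  ∃ S : Set (CoordRing σ), (∀ F ∈ S, ∃ d, IsMultihomogeneous F d) ∧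
    Z = {x | ∀ F ∈ S, evalRep x F = 0}

/-- Zariski open sets. -/
def IsZariskiOpen {ι : Type} {σ : ι → Type} (U : Set (MultiProj σ)) : Prop :=
  IsZariskiClosed Uᶜ

/-- The Zariski closure. -/
def zariskiClosure {ι : Type} {σ : ι → Type} (A : Set (MultiProj σ)) : Set (MultiProj σ) :=
  ⋂₀ {Z | IsZariskiClosed Z ∧ A ⊆ Z}

/-- A map between subsets of products of projective spaces is regular if, in a Zariski
neighbourhood of each point, each of its components is given by multihomogeneous polynomials of
one and the same multidegree without common zero in that neighbourhood. -/
def IsRegularMap {ι κ : Type} {σ : ι → Type} {τ : κ → Type}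
    {X : Set (MultiProj σ)} {Y : Set (MultiProj τ)} (f : X → Y) : Prop :=
  ∀ (x : X) (j : κ), ∃ U : Set (MultiProj σ), IsZariskiOpen U ∧ (x : MultiProj σ) ∈ U ∧
    ∃ (d : ι →₀ ℕ) (G : τ j → CoordRing σ), (∀ k, IsMultihomogeneous (G k) d) ∧
      ∀ y : X, (y : MultiProj σ) ∈ U →
        ∃ h : (fun k => evalRep (y : MultiProj σ) (G k)) ≠ 0,
          (f y : MultiProj τ) j = Projectivization.mk ℂ _ h

/-- Isomorphism of varieties: a bijection that is regular in both directions. -/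
def AreIsomorphic {ι κ : Type} {σ : ι → Type} {τ : κ → Type}
    (X : Set (MultiProj σ)) (Y : Set (MultiProj τ)) : Prop :=
  ∃ e : X ≃ Y, IsRegularMap (e : X → Y) ∧ IsRegularMap (e.symm : Y → X)

/-! ### Segre varieties and their hyperplane sections -/

/-- The decomposable tensor `v 0 ⊗ ⋯ ⊗ v (n - 1)` in `(ℂ²)^{⊗ n}`, in coordinates. -/
def pureTensor {n : ℕ} (v : Fin n → Fin 2 → ℂ) : (Fin n → Fin 2) → ℂ :=
  fun s => ∏ i, v i (s i)

theorem pureTensor_ne_zero {n : ℕ} {v : Fin n → Fin 2 → ℂ} (hv : ∀ i, v i ≠ 0) :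
    pureTensor v ≠ 0 := by
  choose s hs using fun i => Function.ne_iff.mp (hv i)
  exact Function.ne_iff.mpr ⟨s, Finset.prod_ne_zero_iff.mpr fun i _ => hs i⟩

/-- The Segre embedding of the product of `n` projective lines in the projective space of
dimension `2 ^ n - 1`. -/
def segreMap (n : ℕ) (x : MultiProj (fun _ : Fin n => Fin 2)) : ProjSpace (Fin n → Fin 2) :=
  fun _ => Projectivization.mk ℂ (pureTensor fun i => (x i).rep)
    (pureTensor_ne_zero fun i => (x i).rep_nonzero)

/-- The Segre variety `Seg(1, n)`. -/
def Seg (n : ℕ) : Set (ProjSpace (Fin n → Fin 2)) :=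
  Set.range (segreMap n)

/-- The hyperplane with equation `∑ s, a s * X s = 0`, for `a` in the dual projective space. -/
def hyperplane {σ : Type} [Fintype σ] (a : ProjSpace σ) : Set (ProjSpace σ) :=
  {P | ∑ s, (a ()).rep s * (P ()).rep s = 0}

/-- The linear subspace whose projectivization is the embedded tangent space of `Seg(1, n)` at
the image of `x`: it is spanned by the tensors obtained from `x 0 ⊗ ⋯ ⊗ x (n - 1)` by changing
one factor. -/
def segreTangent (n : ℕ) (x : MultiProj (fun _ : Fin n => Fin 2)) :
    Submodule ℂ ((Fin n → Fin 2) → ℂ) :=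
  Submodule.span ℂ {t | ∃ (i : Fin n) (w : Fin 2 → ℂ),
    t = pureTensor (Function.update (fun j => (x j).rep) i w)}

/-- The hyperplane `a` is transverse to `Seg(1, n)`: it contains the embedded tangent space of
`Seg(1, n)` at none of its points. -/
def IsTransverseToSeg (n : ℕ) (a : ProjSpace (Fin n → Fin 2)) : Prop :=
  ∀ x : MultiProj (fun _ : Fin n => Fin 2),
    ∃ t ∈ segreTangent n x, ∑ s, (a ()).rep s * t s ≠ 0

/-! ### The Togliatti surface and blow-ups of the plane -/

/-- Seven cubic forms, a basis of the plane cubics through the three coordinate points. -/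
def togliattiCubics (x : Fin 3 → ℂ) : Fin 7 → ℂ :=
  ![x 0 * x 1 * x 2, x 0 ^ 2 * x 1, x 0 ^ 2 * x 2, x 1 ^ 2 * x 2, x 1 * x 2 ^ 2,
    x 0 * x 1 ^ 2, x 0 * x 2 ^ 2]

/-- The Togliatti surface `S₆` in projective 6-space: the image of the rational map of the plane
given by the seven cubics, that is, the closure of the set of its values. -/
def togliattiSurface : Set (ProjSpace (Fin 7)) :=
  zariskiClosure {P | ∃ (x : Fin 3 → ℂ) (h : togliattiCubics x ≠ 0),
    P = fun _ => Projectivization.mk ℂ (togliattiCubics x) h}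

/-- The blow-up of the projective plane at the points `p k`: the closure of the graph of the map
that sends a point `x` distinct from all the `p k` to the family of the lines joining `x` to
`p k` (the projections from the `p k`). A line is a point of the dual plane, and the line joining
two distinct points has as coordinates their cross product. The component `none` of a point of
the blow-up is its image in the plane. -/
def blowUpPlane {κ : Type} (p : κ → ℙ ℂ (Fin 3 → ℂ)) :
    Set (MultiProj (fun _ : Option κ => Fin 3)) :=
  zariskiClosure {P | ∀ k, P none ≠ p k ∧ P (some k) = Projectivization.cross (P none) (p k)}

end

end Togliatti

namespace Togliatti

open scoped LinearAlgebra.Projectivization Matrix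

noncomputable section

/-! ### Multihomogeneous polynomials -/

section Multihomogeneous

variable {ι κ : Type} {σ : ι → Type} {τ : κ → Type}

/-! All the surfaces are compared with one model, `hexagonSurface`, the divisor `a₀b₀c₀ + a₁b₁c₁ =
0` of tridegree `(1,1,1)` in a product of three lines.

Hyperplane sections: the Segre embedding turns the section by a hyperplane with coefficient tensor
`T` into the divisor defined by `T`. If the hyperdeterminant and the determinant of a slice are
nonzero, `T = u₁⊗u₂⊗u₃ + v₁⊗v₂⊗v₃` with `uᵢ, vᵢ` independent for every `i` (`exists_isGeneralSum`).
A change of coordinates in each factor then gives the model, and the same normal form yields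
transversality.

Togliatti surface: up to sign the seven cubics are the entries of `(x₁,-x₀)⊗(x₂,-x₁)⊗(x₀,-x₂)`, with
`x₀x₁x₂` occurring twice with opposite signs. Thus the surface lies in the section of the Segre
variety by `T₀₀₀ + T₁₁₁ = 0`; conversely, explicit curves show that each point of this section is a
value of the cubics or a limit of values.

Blow-up: it is cut out by incidence relations (`blowUpPlane_eq_incidence`), and a projectivity moves
the three points to the coordinate points. Lines `(0,a₀,a₁)`, `(b₁,0,b₀)`, `(c₀,c₁,0)` through these
have determinant `a₀b₀c₀ + a₁b₁c₁`, so they are concurrent exactly on the model. Two of them are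
always distinct, and their intersection recovers the point of the plane. -/

theorem isMultihomogeneous_X (i : ι) (k : σ i) :
    IsMultihomogeneous (MvPolynomial.X ⟨i, k⟩ : CoordRing σ) (Finsupp.single i 1) :=
  MvPolynomial.isWeightedHomogeneous_X ℂ (fun v : Σ i, σ i => Finsupp.single v.1 1) ⟨i, k⟩

theorem isMultihomogeneous_C_mul_X (c : ℂ) (i : ι) (k : σ i) :
    IsMultihomogeneous (MvPolynomial.C c * MvPolynomial.X ⟨i, k⟩ : CoordRing σ)
      (Finsupp.single i 1) :=
  (isMultihomogeneous_X i k).C_mul c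

/-- The right side is the factor gained by the monomial `m` when the `i`-th block of variables is
scaled by `c i`; the left side shows that it depends only on the multidegree. -/
theorem prod_weight_single (c : ι → ℂ) (m : (Σ i, σ i) →₀ ℕ) :
    (Finsupp.weight (fun v : Σ i, σ i => (Finsupp.single v.1 1 : ι →₀ ℕ)) m).prod
      (fun i n => c i ^ n) = m.prod fun v n => c v.1 ^ n := by
  classical
  induction m using Finsupp.induction_linear with
  | zero => simp
  | add f g hf hg =>
    rw [map_add, Finsupp.prod_add_index' (by simp) (fun _ _ _ => pow_add _ _ _), hf, hg,
      Finsupp.prod_add_index' (by simp) (fun _ _ _ => pow_add _ _ _)]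
  | single v n =>
    simp [Finsupp.weight_apply, Finsupp.smul_single, Finsupp.prod_single_index]

theorem sum_weight_single {M : Type*} [AddCommMonoid M] (D : ι → M) (m : (Σ i, σ i) →₀ ℕ) :
    (Finsupp.weight (fun v : Σ i, σ i => (Finsupp.single v.1 1 : ι →₀ ℕ)) m).sum
      (fun i n => n • D i) = m.sum fun v n => n • D v.1 := by
  classical
  induction m using Finsupp.induction_linear with
  | zero => simp
  | add f g hf hg =>
    rw [map_add, Finsupp.sum_add_index' (by simp) (fun _ _ _ => add_smul _ _ _), hf, hg,
      Finsupp.sum_add_index' (by simp) (fun _ _ _ => add_smul _ _ _)]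
  | single v n =>
    simp [Finsupp.weight_apply, Finsupp.smul_single, Finsupp.sum_single_index]

/-- Rescaling the homogeneous coordinates of the factors rescales the value of a multihomogeneous
polynomial. -/
theorem IsMultihomogeneous.eval_smul {F : CoordRing σ} {d : ι →₀ ℕ}
    (hF : IsMultihomogeneous F d) (c : ι → ℂ) (v : ∀ i, σ i → ℂ) :
    MvPolynomial.eval (fun p : Σ i, σ i => c p.1 * v p.1 p.2) F =
      (d.prod fun i n => c i ^ n) * MvPolynomial.eval (fun p : Σ i, σ i => v p.1 p.2) F := by
  rw [MvPolynomial.eval_eq, MvPolynomial.eval_eq, Finset.mul_sum]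
  refine Finset.sum_congr rfl fun m hm => ?_
  rw [← hF (MvPolynomial.mem_support_iff.mp hm), prod_weight_single, Finsupp.prod]
  simp only [mul_pow, Finset.prod_mul_distrib]
  ring

/-- Substituting multihomogeneous polynomials in a multihomogeneous polynomial. -/
theorem IsMultihomogeneous.bind₁ {F : CoordRing τ} {d : κ →₀ ℕ} (hF : IsMultihomogeneous F d)
    {D : κ → ι →₀ ℕ} {G : ∀ k, τ k → CoordRing σ}
    (hG : ∀ k l, IsMultihomogeneous (G k l) (D k)) :
    IsMultihomogeneous (MvPolynomial.bind₁ (fun p : Σ k, τ k => G p.1 p.2) F)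
      (d.sum fun k n => n • D k) := by
  rw [F.as_sum, map_sum]
  refine MvPolynomial.IsWeightedHomogeneous.sum _ _ _ fun m hm => ?_
  rw [MvPolynomial.bind₁_monomial, ← hF (MvPolynomial.mem_support_iff.mp hm), sum_weight_single]
  exact (MvPolynomial.IsWeightedHomogeneous.prod _ _ _ fun p _ => (hG p.1 p.2).pow _).C_mul _

theorem eval_bind₁ (G : ∀ k, τ k → CoordRing σ) (F : CoordRing τ) (v : (Σ i, σ i) → ℂ) :
    MvPolynomial.eval v (MvPolynomial.bind₁ (fun p : Σ k, τ k => G p.1 p.2) F) =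
      MvPolynomial.eval (fun p : Σ k, τ k => MvPolynomial.eval v (G p.1 p.2)) F :=
  MvPolynomial.eval₂Hom_bind₁ _ _ _ _

end Multihomogeneous

/-! ### Points with given homogeneous coordinates -/

section Points

variable {ι : Type} {σ : ι → Type}

/-- The point with given homogeneous coordinates. -/
def point (v : ∀ i, σ i → ℂ) (hv : ∀ i, v i ≠ 0) : MultiProj σ :=
  fun i => Projectivization.mk ℂ (v i) (hv i)

theorem exists_rep_mk_eq {s : Type} (v : s → ℂ) (hv : v ≠ 0) :
    ∃ c : ℂ, c ≠ 0 ∧ (Projectivization.mk ℂ v hv).rep = c • v := by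
  obtain ⟨a, ha⟩ := Projectivization.exists_smul_eq_mk_rep ℂ v hv
  exact ⟨a, a.ne_zero, ha.symm⟩

theorem exists_rep_point_eq (v : ∀ i, σ i → ℂ) (hv : ∀ i, v i ≠ 0) :
    ∃ c : ι → ℂ, (∀ i, c i ≠ 0) ∧ ∀ i, (point v hv i).rep = c i • v i := by
  choose c hc h using fun i => exists_rep_mk_eq (v i) (hv i)
  exact ⟨c, hc, h⟩

theorem evalRep_point_eq_zero_iff {F : CoordRing σ} {d : ι →₀ ℕ} (hF : IsMultihomogeneous F d)
    (v : ∀ i, σ i → ℂ) (hv : ∀ i, v i ≠ 0) :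
    evalRep (point v hv) F = 0 ↔ MvPolynomial.eval (fun p : Σ i, σ i => v p.1 p.2) F = 0 := by
  obtain ⟨c, hc, h⟩ := exists_rep_point_eq v hv
  have : evalRep (point v hv) F =
      (d.prod fun i n => c i ^ n) * MvPolynomial.eval (fun p : Σ i, σ i => v p.1 p.2) F := by
    rw [← hF.eval_smul c v]
    simp only [evalRep, h, Pi.smul_apply, smul_eq_mul]
  rw [this, mul_eq_zero, or_iff_right]
  exact Finset.prod_ne_zero_iff.mpr fun i _ => pow_ne_zero _ (hc i)

/-- Proportionality of vectors, in coordinates. -/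
theorem exists_eq_smul_of_mul_eq_mul {s : Type} {v w : s → ℂ} (hv : v ≠ 0)
    (h : ∀ k l, w k * v l = w l * v k) : ∃ c : ℂ, w = c • v := by
  obtain ⟨l, hl⟩ := Function.ne_iff.mp hv
  simp only [Pi.zero_apply] at hl
  refine ⟨w l / v l, funext fun k => ?_⟩
  rw [Pi.smul_apply, smul_eq_mul, div_mul_eq_mul_div, eq_div_iff hl, h]

theorem mk_eq_mk_of_mul_eq_mul {s : Type} {v w : s → ℂ} (hv : v ≠ 0) (hw : w ≠ 0)
    (h : ∀ k l, w k * v l = w l * v k) :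
    Projectivization.mk ℂ w hw = Projectivization.mk ℂ v hv := by
  obtain ⟨c, hc⟩ := exists_eq_smul_of_mul_eq_mul hv h
  exact (Projectivization.mk_eq_mk_iff' ℂ w v hw hv).mpr ⟨c, hc.symm⟩

theorem eq_mk_of_mul_rep_eq {s : Type} {x : ℙ ℂ (s → ℂ)} {w : s → ℂ} (hw : w ≠ 0)
    (h : ∀ k l, w k * x.rep l = w l * x.rep k) : x = Projectivization.mk ℂ w hw := by
  rw [mk_eq_mk_of_mul_eq_mul x.rep_nonzero hw h, Projectivization.mk_rep]

theorem mul_rep_mk_comm {s : Type} (w : s → ℂ) (hw : w ≠ 0) (k l : s) :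
    w k * (Projectivization.mk ℂ w hw).rep l = w l * (Projectivization.mk ℂ w hw).rep k := by
  obtain ⟨c, -, h⟩ := exists_rep_mk_eq w hw
  simp only [h, Pi.smul_apply, smul_eq_mul]
  ring

end Points

/-! ### Regular maps and isomorphisms -/

section Regular

variable {ι κ μ : Type} {σ : ι → Type} {τ : κ → Type} {ρ : μ → Type}
  {X : Set (MultiProj σ)} {Y : Set (MultiProj τ)} {Z : Set (MultiProj ρ)}

/-- A map is regular if and only if each of its components is proportional, at all points, to
values of multihomogeneous polynomials of the same multidegree that do not all vanish at a given
point. -/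
theorem isRegularMap_iff {f : X → Y} :
    IsRegularMap f ↔ ∀ (x : X) (j : κ), ∃ (d : ι →₀ ℕ) (G : τ j → CoordRing σ),
      (∀ k, IsMultihomogeneous (G k) d) ∧ (∃ k, evalRep (x : MultiProj σ) (G k) ≠ 0) ∧
      ∀ (y : X) (k l : τ j), evalRep (y : MultiProj σ) (G k) * ((f y : MultiProj τ) j).rep l =
        evalRep (y : MultiProj σ) (G l) * ((f y : MultiProj τ) j).rep k := by
  constructor
  · intro h x j
    obtain ⟨U, ⟨S, hS, hU⟩, hx, d, G, hG, hf⟩ := h x j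
    have hx' : (x : MultiProj σ) ∉ {x | ∀ F ∈ S, evalRep x F = 0} := by
      rw [← hU]; exact fun h => h hx
    simp only [Set.mem_ofPred_eq, not_forall] at hx'
    obtain ⟨F, hFS, hF⟩ := hx'
    obtain ⟨e, he⟩ := hS F hFS
    -- `F` vanishes off `U` but not at `x`. Multiplying the `G k` by it makes the proportionality
    -- hold on all of `X`: off `U` both sides are zero.
    have hmul : ∀ (y : MultiProj σ) (k), evalRep y (F * G k) = evalRep y F * evalRep y (G k) :=
      fun y k => map_mul _ _ _
    refine ⟨e + d, fun k => F * G k, fun k => he.mul (hG k), ?_, fun y k l => ?_⟩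
    · obtain ⟨hne, -⟩ := hf x hx
      obtain ⟨k, hk⟩ := Function.ne_iff.mp hne
      exact ⟨k, by rw [hmul]; exact mul_ne_zero hF hk⟩
    · rw [hmul, hmul]
      by_cases hy : evalRep (y : MultiProj σ) F = 0
      · rw [hy]; ring
      · have hyU : (y : MultiProj σ) ∈ U := by
          by_contra hc
          have : (y : MultiProj σ) ∈ {x | ∀ F ∈ S, evalRep x F = 0} := by rw [← hU]; exact hc
          exact hy (this F hFS)
        obtain ⟨hne, hfy⟩ := hf y hyU
        rw [hfy, mul_assoc, mul_assoc, mul_rep_mk_comm _ hne k l]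
  · intro h x j
    obtain ⟨d, G, hG, ⟨k, hk⟩, hf⟩ := h x j
    refine ⟨{y | ∃ k, evalRep y (G k) ≠ 0}, ⟨Set.range G, ?_, ?_⟩, ⟨k, hk⟩, d, G, hG, ?_⟩
    · rintro _ ⟨k, rfl⟩
      exact ⟨d, hG k⟩
    · ext y
      simp
    · rintro y ⟨k, hk⟩
      have hne : (fun k => evalRep (y : MultiProj σ) (G k)) ≠ 0 := Function.ne_iff.mpr ⟨k, hk⟩
      exact ⟨hne, eq_mk_of_mul_rep_eq hne (hf y)⟩

/-- Representatives of `f` are substituted in those of `g`. At each point they differ from the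
chosen coordinates of `f y` by scalars `c k`, and multihomogeneity turns these into one common
factor. This factor is nonzero at `x`; where it vanishes, the cross-multiplied identities still
hold. -/
theorem IsRegularMap.comp {g : Y → Z} {f : X → Y} (hg : IsRegularMap g) (hf : IsRegularMap f) :
    IsRegularMap (g ∘ f) := by
  rw [isRegularMap_iff] at hf hg ⊢
  intro x j
  obtain ⟨d, G, hG, ⟨m, hm⟩, hgG⟩ := hg (f x) j
  choose D F hF hx hfF using hf x
  have key : ∀ y : X, ∃ c : κ → ℂ,
      (∀ k, (fun l => evalRep (y : MultiProj σ) (F k l)) = c k • ((f y : MultiProj τ) k).rep) ∧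
      ∀ n, evalRep (y : MultiProj σ)
        (MvPolynomial.bind₁ (fun p : Σ k, τ k => F p.1 p.2) (G n)) =
        (d.prod fun i n => c i ^ n) * evalRep (f y : MultiProj τ) (G n) := by
    intro y
    choose c hc using fun k => exists_eq_smul_of_mul_eq_mul
      ((f y : MultiProj τ) k).rep_nonzero (hfF k y)
    refine ⟨c, hc, fun n => ?_⟩
    rw [evalRep, eval_bind₁, evalRep, ← (hG n).eval_smul c fun k => ((f y : MultiProj τ) k).rep]
    congr 2
    funext p
    exact congrFun (hc p.1) p.2
  refine ⟨_, fun n => MvPolynomial.bind₁ (fun p : Σ k, τ k => F p.1 p.2) (G n),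
    fun n => (hG n).bind₁ hF, ⟨m, ?_⟩, fun y k l => ?_⟩
  · obtain ⟨c, hc, h⟩ := key x
    rw [h]
    refine mul_ne_zero (Finset.prod_ne_zero_iff.mpr fun k _ => pow_ne_zero _ fun h0 => ?_) hm
    obtain ⟨l, hl⟩ := hx k
    have := congrFun (hc k) l
    rw [h0, zero_smul] at this
    exact hl this
  · obtain ⟨c, -, h⟩ := key y
    rw [h, h, mul_assoc, mul_assoc, Function.comp_apply, hgG (f y) k l]

theorem AreIsomorphic.symm (h : AreIsomorphic X Y) : AreIsomorphic Y X := by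
  obtain ⟨e, h₁, h₂⟩ := h
  exact ⟨e.symm, h₂, by simpa using h₁⟩

theorem AreIsomorphic.trans (h : AreIsomorphic X Y) (h' : AreIsomorphic Y Z) :
    AreIsomorphic X Z := by
  obtain ⟨e, h₁, h₂⟩ := h
  obtain ⟨e', h₁', h₂'⟩ := h'
  exact ⟨e.trans e', h₁'.comp h₁, h₂.comp h₂'⟩

/-- A surjective regular map is an isomorphism as soon as each point of the source is locally
recovered from its image by multihomogeneous polynomials. -/
theorem areIsomorphic_of_surjective (f : X → Y) (hf : IsRegularMap f)
    (hsurj : Function.Surjective f)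
    (hinv : ∀ (x : X) (i : ι), ∃ (d : κ →₀ ℕ) (G : σ i → CoordRing τ),
      (∀ k, IsMultihomogeneous (G k) d) ∧ (∃ k, evalRep (f x : MultiProj τ) (G k) ≠ 0) ∧
      ∀ (y : X) (k l : σ i), evalRep (f y : MultiProj τ) (G k) * ((y : MultiProj σ) i).rep l =
        evalRep (f y : MultiProj τ) (G l) * ((y : MultiProj σ) i).rep k) :
    AreIsomorphic X Y := by
  -- Two points with the same image are both represented by the same nonzero vector of values of the
  -- `G k`.
  have hinj : Function.Injective f := by
    intro x x' hxx
    refine Subtype.ext (funext fun i => ?_)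
    obtain ⟨d, G, -, ⟨k, hk⟩, h⟩ := hinv x i
    have hne : (fun k => evalRep (f x : MultiProj τ) (G k)) ≠ 0 := Function.ne_iff.mpr ⟨k, hk⟩
    have h' := h x'
    rw [← hxx] at h'
    exact (eq_mk_of_mul_rep_eq hne (h x)).trans (eq_mk_of_mul_rep_eq hne h').symm
  refine ⟨Equiv.ofBijective f ⟨hinj, hsurj⟩, hf, isRegularMap_iff.mpr fun y i => ?_⟩
  obtain ⟨x, rfl⟩ := hsurj y
  obtain ⟨d, G, hG, hk, h⟩ := hinv x i
  refine ⟨d, G, hG, hk, fun y k l => ?_⟩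
  obtain ⟨x', rfl⟩ := hsurj y
  have : (Equiv.ofBijective f ⟨hinj, hsurj⟩).symm (f x') = x' :=
    Equiv.ofBijective_symm_apply_apply f ⟨hinj, hsurj⟩ x'
  rw [this]
  exact h x' k l

end Regular

/-! ### Factorwise linear maps -/

section Linear

variable {ι : Type} {σ τ : ι → Type} [∀ i, Fintype (σ i)] [∀ i, Fintype (τ i)]

/-- The linear form `∑ k, a k * X k` in the coordinates of one factor. -/
def linearPoly (i : ι) (a : σ i → ℂ) : CoordRing σ :=
  ∑ k, MvPolynomial.C (a k) * MvPolynomial.X ⟨i, k⟩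

theorem isMultihomogeneous_linearPoly (i : ι) (a : σ i → ℂ) :
    IsMultihomogeneous (linearPoly i a) (Finsupp.single i 1) :=
  MvPolynomial.IsWeightedHomogeneous.sum _ _ _ fun k _ => isMultihomogeneous_C_mul_X (a k) i k

theorem eval_linearPoly (i : ι) (a : σ i → ℂ) (v : (Σ i, σ i) → ℂ) :
    MvPolynomial.eval v (linearPoly i a) = ∑ k, a k * v ⟨i, k⟩ := by
  simp [linearPoly]

theorem evalRep_linearPoly (i : ι) (a : σ i → ℂ) (x : MultiProj σ) :
    evalRep x (linearPoly i a) = a ⬝ᵥ (x i).rep :=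
  eval_linearPoly i a _

/-- Factorwise linear maps that are inverse to each other on two subsets are isomorphisms
between these. -/
theorem areIsomorphic_of_linear {X : Set (MultiProj σ)} {Y : Set (MultiProj τ)}
    (A : ∀ i, Matrix (τ i) (σ i) ℂ) (B : ∀ i, Matrix (σ i) (τ i) ℂ)
    (hA : ∀ x ∈ X, ∀ i, B i *ᵥ (A i *ᵥ (x i).rep) = (x i).rep)
    (hB : ∀ y ∈ Y, ∀ i, A i *ᵥ (B i *ᵥ (y i).rep) = (y i).rep)
    (hXY : ∀ x ∈ X, ∀ h : ∀ i, A i *ᵥ (x i).rep ≠ 0, point (fun i => A i *ᵥ (x i).rep) h ∈ Y)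
    (hYX : ∀ y ∈ Y, ∀ h : ∀ i, B i *ᵥ (y i).rep ≠ 0, point (fun i => B i *ᵥ (y i).rep) h ∈ X) :
    AreIsomorphic X Y := by
  have hA0 : ∀ x ∈ X, ∀ i, A i *ᵥ (x i).rep ≠ 0 := fun x hx i h =>
    (x i).rep_nonzero (by rw [← hA x hx i, h, Matrix.mulVec_zero])
  have hB0 : ∀ y ∈ Y, ∀ i, B i *ᵥ (y i).rep ≠ 0 := fun y hy i h =>
    (y i).rep_nonzero (by rw [← hB y hy i, h, Matrix.mulVec_zero])
  let f : X → Y := fun x => ⟨_, hXY x x.2 (hA0 x x.2)⟩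
  have hfrep : ∀ (x : X) i, ∃ c : ℂ, c ≠ 0 ∧ ((f x : MultiProj τ) i).rep = c • (A i *ᵥ (x.1 i).rep) :=
    fun x i => exists_rep_mk_eq _ (hA0 x x.2 i)
  refine areIsomorphic_of_surjective f (isRegularMap_iff.mpr fun x i => ?_) ?_ fun x i => ?_
  · refine ⟨_, fun k => linearPoly i (A i k), fun k => isMultihomogeneous_linearPoly i _, ?_, ?_⟩
    · obtain ⟨k, hk⟩ := Function.ne_iff.mp (hA0 x x.2 i)
      exact ⟨k, by rw [evalRep_linearPoly]; exact hk⟩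
    · intro y k l
      rw [evalRep_linearPoly, evalRep_linearPoly]
      exact mul_rep_mk_comm _ (hA0 y y.2 i) k l
  · intro y
    refine ⟨⟨_, hYX y y.2 (hB0 y y.2)⟩, Subtype.ext (funext fun i => ?_)⟩
    refine Eq.trans ?_ (y.1 i).mk_rep
    obtain ⟨c, hc, h⟩ := exists_rep_mk_eq _ (hB0 y y.2 i)
    refine (Projectivization.mk_eq_mk_iff' ℂ _ _ _ _).mpr ⟨c, ?_⟩
    change _ = A i *ᵥ (Projectivization.mk ℂ _ (hB0 y y.2 i)).rep
    rw [h, Matrix.mulVec_smul, hB y y.2]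
  · have key : ∀ y : X, ∃ c : ℂ, c ≠ 0 ∧
        ∀ k, evalRep (f y : MultiProj τ) (linearPoly i (B i k)) = c * (y.1 i).rep k := by
      intro y
      obtain ⟨c, hc, h⟩ := hfrep y i
      refine ⟨c, hc, fun k => ?_⟩
      rw [evalRep_linearPoly, h, dotProduct_smul]
      exact congrArg (c • ·) (congrFun (hA y y.2 i) k)
    refine ⟨_, fun k => linearPoly i (B i k), fun k => isMultihomogeneous_linearPoly i _, ?_, ?_⟩
    · obtain ⟨c, hc, h⟩ := key x
      obtain ⟨k, hk⟩ := Function.ne_iff.mp (x.1 i).rep_nonzero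
      exact ⟨k, by rw [h]; exact mul_ne_zero hc hk⟩
    · intro y k l
      obtain ⟨c, -, h⟩ := key y
      rw [h, h]
      ring

end Linear

/-! ### Limits in Zariski closed sets -/

section Closure

variable {ι : Type} {σ : ι → Type}

theorem subset_zariskiClosure (A : Set (MultiProj σ)) : A ⊆ zariskiClosure A :=
  Set.subset_sInter fun _ hZ => hZ.2

theorem zariskiClosure_subset {A Z : Set (MultiProj σ)} (hZ : IsZariskiClosed Z) (h : A ⊆ Z) :
    zariskiClosure A ⊆ Z :=
  Set.sInter_subset_of_mem ⟨hZ, h⟩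

open Filter Topology in
/-- The Zariski closure contains the limits along punctured continuous curves. -/
theorem point_mem_zariskiClosure {A : Set (MultiProj σ)} {γ : ℂ → ∀ i, σ i → ℂ}
    (hγ : Continuous γ) {r : ℂ} (h0 : ∀ i, γ r i ≠ 0)
    (h : ∀ᶠ s in 𝓝[≠] r, ∃ hs : ∀ i, γ s i ≠ 0, point (γ s) hs ∈ A) :
    point (γ r) h0 ∈ zariskiClosure A := by
  rintro _ ⟨⟨S, hS, rfl⟩, hA⟩ F hF
  obtain ⟨d, hd⟩ := hS F hF
  rw [evalRep_point_eq_zero_iff hd]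
  have hcont : Continuous fun s => MvPolynomial.eval (fun p : Σ i, σ i => γ s p.1 p.2) F := by
    refine (MvPolynomial.continuous_eval F).comp (continuous_pi fun p => ?_)
    exact (continuous_apply p.2).comp ((continuous_apply p.1).comp hγ)
  have hlim := hcont.continuousAt.tendsto.mono_left (nhdsWithin_le_nhds (s := {r}ᶜ) (a := r))
  refine tendsto_nhds_unique hlim (tendsto_const_nhds.congr' ?_)
  filter_upwards [h] with s hs
  obtain ⟨hs, hmem⟩ := hs
  exact ((evalRep_point_eq_zero_iff hd _ hs).mp (hA hmem F hF)).symm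

end Closure

/-! ### Hyperplane sections of Segre varieties as hypersurfaces in products of lines -/

section Segre

variable {n : ℕ}

theorem pureTensor_smul (c : Fin n → ℂ) (v : Fin n → Fin 2 → ℂ) :
    pureTensor (fun i => c i • v i) = (∏ i, c i) • pureTensor v := by
  funext s
  simp [pureTensor, Finset.prod_mul_distrib]

theorem pureTensor_update_right (v : Fin n → Fin 2 → ℂ) (s : Fin n → Fin 2) (i : Fin n)
    (k : Fin 2) :
    pureTensor v (Function.update s i k) = v i k * ∏ j ∈ Finset.univ.erase i, v j (s j) := by
  rw [pureTensor, ← Finset.mul_prod_erase _ _ (Finset.mem_univ i), Function.update_self]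
  congr 1
  refine Finset.prod_congr rfl fun j hj => ?_
  rw [Function.update_of_ne (Finset.ne_of_mem_erase hj)]

theorem sum_pureTensor_mul (u v : Fin n → Fin 2 → ℂ) :
    ∑ s, pureTensor u s * pureTensor v s = ∏ i, u i ⬝ᵥ v i := by
  simp only [dotProduct, Finset.prod_univ_sum, Fintype.piFinset_univ, pureTensor,
    Finset.prod_mul_distrib]

theorem exists_rep_segreMap_eq (q : MultiProj (fun _ : Fin n => Fin 2)) :
    ∃ c : ℂ, c ≠ 0 ∧ (segreMap n q ()).rep = c • pureTensor fun i => (q i).rep :=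
  exists_rep_mk_eq _ _

theorem mem_Seg_iff {P : ProjSpace (Fin n → Fin 2)} :
    P ∈ Seg n ↔ ∃ (c : ℂ) (v : Fin n → Fin 2 → ℂ), (∀ i, v i ≠ 0) ∧
      (P ()).rep = c • pureTensor v := by
  constructor
  · rintro ⟨q, rfl⟩
    obtain ⟨c, -, h⟩ := exists_rep_segreMap_eq q
    exact ⟨c, _, fun i => (q i).rep_nonzero, h⟩
  · rintro ⟨c, v, hv, h⟩
    refine ⟨point v hv, funext fun u => ?_⟩
    obtain ⟨e, he, hr⟩ := exists_rep_point_eq v hv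
    rw [← (P u).mk_rep]
    refine (Projectivization.mk_eq_mk_iff ℂ _ _ _ _).mpr ?_
    have hc : c ≠ 0 := by
      rintro rfl
      exact (P ()).rep_nonzero (by rw [h, zero_smul])
    have hp : ∏ i, e i ≠ 0 := Finset.prod_ne_zero_iff.mpr fun i _ => he i
    refine ⟨Units.mk0 ((∏ i, e i) / c) (div_ne_zero hp hc), ?_⟩
    have : pureTensor (fun i => (point v hv i).rep) = (∏ i, e i) • pureTensor v := by
      rw [← pureTensor_smul]
      exact congrArg pureTensor (funext hr)
    rw [this, h, Units.smul_mk0, smul_smul, div_mul_cancel₀ _ hc]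

/-- The hypersurface of multidegree `(1, …, 1)` in a product of lines defined by a tensor. -/
def tensorLocus (T : (Fin n → Fin 2) → ℂ) : Set (MultiProj (fun _ : Fin n => Fin 2)) :=
  {q | ∑ s, T s * pureTensor (fun i => (q i).rep) s = 0}

theorem segreMap_mem_hyperplane_iff (a : ProjSpace (Fin n → Fin 2))
    (q : MultiProj (fun _ : Fin n => Fin 2)) :
    segreMap n q ∈ hyperplane a ↔ q ∈ tensorLocus (a ()).rep := by
  obtain ⟨c, hc, h⟩ := exists_rep_segreMap_eq q
  change _ ⬝ᵥ _ = 0 ↔ _ ⬝ᵥ _ = 0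
  rw [h, dotProduct_smul, smul_eq_zero_iff_right hc]

/-- The coordinates of the Segre embedding, as polynomials. -/
def segreMonomial (s : Fin n → Fin 2) : CoordRing (fun _ : Fin n => Fin 2) :=
  ∏ i, MvPolynomial.X ⟨i, s i⟩

theorem isMultihomogeneous_segreMonomial (s : Fin n → Fin 2) :
    IsMultihomogeneous (segreMonomial s) (∑ i, Finsupp.single i 1) :=
  MvPolynomial.IsWeightedHomogeneous.prod Finset.univ
    (fun i => (MvPolynomial.X ⟨i, s i⟩ : CoordRing (fun _ : Fin n => Fin 2)))
    (fun i => Finsupp.single i 1) fun i _ =>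
      isMultihomogeneous_X (σ := fun _ : Fin n => Fin 2) i (s i)

theorem evalRep_segreMonomial (s : Fin n → Fin 2) (q : MultiProj (fun _ : Fin n => Fin 2)) :
    evalRep q (segreMonomial s) = pureTensor (fun i => (q i).rep) s := by
  simp [evalRep, pureTensor, segreMonomial, map_prod]

/-- The Segre embedding identifies hyperplane sections with hypersurfaces of multidegree
`(1, …, 1)`. -/
theorem areIsomorphic_tensorLocus_hyperplane (a : ProjSpace (Fin n → Fin 2)) :
    AreIsomorphic (tensorLocus (a ()).rep) (hyperplane a ∩ Seg n) := by
  let f : tensorLocus (a ()).rep → (hyperplane a ∩ Seg n : Set _) :=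
    fun q => ⟨segreMap n q, (segreMap_mem_hyperplane_iff a q).mpr q.2, ⟨q, rfl⟩⟩
  refine areIsomorphic_of_surjective f (isRegularMap_iff.mpr fun x _ => ?_) ?_ fun x i => ?_
  · refine ⟨_, segreMonomial, isMultihomogeneous_segreMonomial, ?_, fun y k l => ?_⟩
    · obtain ⟨s, hs⟩ := Function.ne_iff.mp
        (pureTensor_ne_zero fun i => (x.1 i).rep_nonzero)
      exact ⟨s, by rw [evalRep_segreMonomial]; exact hs⟩
    · rw [evalRep_segreMonomial, evalRep_segreMonomial]
      exact mul_rep_mk_comm _ (pureTensor_ne_zero fun i => (y.1 i).rep_nonzero) k l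
  · rintro ⟨_, hP, q, rfl⟩
    exact ⟨⟨q, (segreMap_mem_hyperplane_iff a q).mp hP⟩, rfl⟩
  · obtain ⟨s, hs⟩ := Function.ne_iff.mp
      (pureTensor_ne_zero fun i => (x.1 i).rep_nonzero)
    -- At an index `s` where the pure tensor does not vanish, varying only the `i`-th index gives a
    -- multiple of the `i`-th factor.
    refine ⟨_, fun k => MvPolynomial.X ⟨(), Function.update s i k⟩,
      fun k => isMultihomogeneous_X _ _, ⟨s i, ?_⟩, fun y k l => ?_⟩
    · obtain ⟨c, hc, h⟩ := exists_rep_segreMap_eq x.1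
      simp only [evalRep, MvPolynomial.eval_X, Function.update_eq_self, f]
      rw [h]
      exact mul_ne_zero hc hs
    · obtain ⟨c, hc, h⟩ := exists_rep_segreMap_eq y.1
      simp only [evalRep, MvPolynomial.eval_X, f]
      rw [h, Pi.smul_apply, Pi.smul_apply, pureTensor_update_right, pureTensor_update_right,
        smul_eq_mul, smul_eq_mul]
      ring

end Segre

/-! ### Tensors of format 2 × 2 × 2 -/

section Tensors

theorem eq_vec3 {α : Type*} (s : Fin 3 → α) : s = ![s 0, s 1, s 2] := by
  funext i
  fin_cases i <;> rfl

theorem sum_fin_three_fun (f : (Fin 3 → Fin 2) → ℂ) :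
    ∑ s, f s = ∑ i, ∑ j, ∑ k, f ![i, j, k] := by
  let e : (Fin 3 → Fin 2) ≃ Fin 2 × Fin 2 × Fin 2 :=
    { toFun := fun s => (s 0, s 1, s 2)
      invFun := fun p => ![p.1, p.2.1, p.2.2]
      left_inv := fun s => (eq_vec3 s).symm
      right_inv := fun _ => rfl }
  rw [← e.symm.sum_comp f, Fintype.sum_prod_type]
  refine Finset.sum_congr rfl fun i _ => ?_
  rw [Fintype.sum_prod_type]
  rfl

/-- The hypersurface `x₀y₀z₀ + x₁y₁z₁ = 0` in the product of three lines. -/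
def hexagonSurface : Set (MultiProj (fun _ : Fin 3 => Fin 2)) :=
  {q | (q 0).rep 0 * (q 1).rep 0 * (q 2).rep 0 + (q 0).rep 1 * (q 1).rep 1 * (q 2).rep 1 = 0}

theorem point_mem_hexagonSurface_iff (v : Fin 3 → Fin 2 → ℂ) (hv : ∀ i, v i ≠ 0) :
    point v hv ∈ hexagonSurface ↔ v 0 0 * v 1 0 * v 2 0 + v 0 1 * v 1 1 * v 2 1 = 0 := by
  obtain ⟨c, hc, h⟩ := exists_rep_point_eq v hv
  simp only [hexagonSurface, Set.mem_ofPred_eq, h, Pi.smul_apply, smul_eq_mul]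
  have : c 0 * v 0 0 * (c 1 * v 1 0) * (c 2 * v 2 0) + c 0 * v 0 1 * (c 1 * v 1 1) *
      (c 2 * v 2 1) = c 0 * c 1 * c 2 * (v 0 0 * v 1 0 * v 2 0 + v 0 1 * v 1 1 * v 2 1) := by
    ring
  rw [this, mul_eq_zero, or_iff_right (mul_ne_zero (mul_ne_zero (hc 0) (hc 1)) (hc 2))]

/-- A tensor is a sum of two decomposable tensors in general position. -/
def IsGeneralSum (T : (Fin 3 → Fin 2) → ℂ) (u v : Fin 3 → Fin 2 → ℂ) : Prop :=
  (∀ i, u i 0 * v i 1 - u i 1 * v i 0 ≠ 0) ∧ T = pureTensor u + pureTensor v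

theorem IsGeneralSum.sum_mul_pureTensor {T : (Fin 3 → Fin 2) → ℂ} {u v : Fin 3 → Fin 2 → ℂ}
    (h : IsGeneralSum T u v) (w : Fin 3 → Fin 2 → ℂ) :
    ∑ s, T s * pureTensor w s = ∏ i, u i ⬝ᵥ w i + ∏ i, v i ⬝ᵥ w i := by
  simp only [h.2, Pi.add_apply, add_mul, Finset.sum_add_distrib, sum_pureTensor_mul]

/-- By independence, the forms `u i` and `v i` are homogeneous coordinates on the `i`-th line; in
these the divisor of `T` has the equation of the model. -/
theorem IsGeneralSum.areIsomorphic {T : (Fin 3 → Fin 2) → ℂ} {u v : Fin 3 → Fin 2 → ℂ}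
    (h : IsGeneralSum T u v) : AreIsomorphic (tensorLocus T) hexagonSurface := by
  let A : Fin 3 → Matrix (Fin 2) (Fin 2) ℂ := fun i => !![u i 0, u i 1; v i 0, v i 1]
  have hdet : ∀ i, IsUnit (A i).det := fun i => by
    rw [isUnit_iff_ne_zero, Matrix.det_fin_two_of]
    exact h.1 i
  have hA : ∀ i w, A i *ᵥ w = ![u i ⬝ᵥ w, v i ⬝ᵥ w] := fun i w => by
    funext k
    fin_cases k <;> simp [A, Matrix.mulVec, dotProduct]
  have hmem : ∀ w : Fin 3 → Fin 2 → ℂ, ∑ s, T s * pureTensor w s = 0 ↔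
      (A 0 *ᵥ w 0) 0 * (A 1 *ᵥ w 1) 0 * (A 2 *ᵥ w 2) 0 +
        (A 0 *ᵥ w 0) 1 * (A 1 *ᵥ w 1) 1 * (A 2 *ᵥ w 2) 1 = 0 := fun w => by
    rw [h.sum_mul_pureTensor, Fin.prod_univ_three, Fin.prod_univ_three]
    simp [hA]
  have hBA : ∀ i w, (A i)⁻¹ *ᵥ (A i *ᵥ w) = w := fun i w => by
    rw [Matrix.mulVec_mulVec, Matrix.nonsing_inv_mul _ (hdet i), Matrix.one_mulVec]
  have hAB : ∀ i w, A i *ᵥ ((A i)⁻¹ *ᵥ w) = w := fun i w => by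
    rw [Matrix.mulVec_mulVec, Matrix.mul_nonsing_inv _ (hdet i), Matrix.one_mulVec]
  refine areIsomorphic_of_linear A (fun i => (A i)⁻¹) (fun x _ i => hBA i _)
    (fun y _ i => hAB i _) (fun x hx h0 => ?_) fun y hy h0 => ?_
  · rw [point_mem_hexagonSurface_iff]
    exact (hmem fun i => (x i).rep).mp hx
  · obtain ⟨c, hc, h⟩ := exists_rep_point_eq _ h0
    have : pureTensor (fun i => (point _ h0 i).rep) =
        (∏ i, c i) • pureTensor fun i => (A i)⁻¹ *ᵥ (y i).rep := by
      rw [← pureTensor_smul]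
      exact congrArg pureTensor (funext h)
    change _ ⬝ᵥ _ = 0
    rw [this, dotProduct_smul]
    refine smul_eq_zero_of_right _ ((hmem fun i => (A i)⁻¹ *ᵥ (y i).rep).mpr ?_)
    simp only [hAB]
    exact hy

theorem pureTensor_update_left (x : Fin 3 → Fin 2 → ℂ) (i : Fin 3) (w : Fin 2 → ℂ)
    (u : Fin 3 → Fin 2 → ℂ) :
    ∏ j, u j ⬝ᵥ Function.update x i w j =
      u i ⬝ᵥ w * ∏ j ∈ Finset.univ.erase i, u j ⬝ᵥ x j := by
  rw [← Finset.mul_prod_erase _ _ (Finset.mem_univ i), Function.update_self]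
  congr 1
  refine Finset.prod_congr rfl fun j hj => ?_
  rw [Function.update_of_ne (Finset.ne_of_mem_erase hj)]

theorem eq_zero_of_dotProduct_eq_zero {u v x : Fin 2 → ℂ} (h : u 0 * v 1 - u 1 * v 0 ≠ 0)
    (hu : u ⬝ᵥ x = 0) (hv : v ⬝ᵥ x = 0) : x = 0 := by
  simp only [dotProduct, Fin.sum_univ_two] at hu hv
  funext k
  refine (mul_eq_zero.mp ?_).resolve_left h
  fin_cases k
  · change (u 0 * v 1 - u 1 * v 0) * x 0 = 0
    linear_combination v 1 * hu - u 1 * hv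
  · change (u 0 * v 1 - u 1 * v 0) * x 1 = 0
    linear_combination u 0 * hv - v 0 * hu

/-- If the hyperplane contained the tangent space at `x`, varying the `i`-th factor would give, by
independence of `u i` and `v i`, the vanishing of the products over `j ≠ i` of `u j ⬝ᵥ x j` and of
`v j ⬝ᵥ x j`. For all `i` together, at least two of the three numbers `u j ⬝ᵥ x j` vanish, and
likewise for `v`. Some `j` is common to both, which forces `x j = 0`. -/
theorem IsGeneralSum.isTransverseToSeg {a : ProjSpace (Fin 3 → Fin 2)}
    {u v : Fin 3 → Fin 2 → ℂ} (h : IsGeneralSum (a ()).rep u v) : IsTransverseToSeg 3 a := by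
  intro x
  by_contra! hx
  have key : ∀ i, (∏ j ∈ Finset.univ.erase i, u j ⬝ᵥ (x j).rep) = 0 ∧
      ∏ j ∈ Finset.univ.erase i, v j ⬝ᵥ (x j).rep = 0 := by
    intro i
    have hw : ∀ w : Fin 2 → ℂ,
        u i ⬝ᵥ w * ∏ j ∈ Finset.univ.erase i, u j ⬝ᵥ (x j).rep +
          v i ⬝ᵥ w * ∏ j ∈ Finset.univ.erase i, v j ⬝ᵥ (x j).rep = 0 := by
      intro w
      have := hx _ (Submodule.subset_span ⟨i, w, rfl⟩)
      rwa [h.sum_mul_pureTensor, pureTensor_update_left, pureTensor_update_left] at this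
    have h0 := hw ![1, 0]
    have h1 := hw ![0, 1]
    have e0 : ∀ w : Fin 2 → ℂ, w ⬝ᵥ ![1, 0] = w 0 := fun w => by simp [dotProduct]
    have e1 : ∀ w : Fin 2 → ℂ, w ⬝ᵥ ![0, 1] = w 1 := fun w => by simp [dotProduct]
    rw [e0, e0] at h0
    rw [e1, e1] at h1
    constructor
    · refine (mul_eq_zero.mp ?_).resolve_left (h.1 i)
      linear_combination v i 1 * h0 - v i 0 * h1
    · refine (mul_eq_zero.mp ?_).resolve_left (h.1 i)
      linear_combination u i 0 * h1 - u i 1 * h0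
  have hne : ∀ i, u i ⬝ᵥ (x i).rep = 0 → v i ⬝ᵥ (x i).rep = 0 → False := fun i h1 h2 =>
    (x i).rep_nonzero (eq_zero_of_dotProduct_eq_zero (h.1 i) h1 h2)
  have e0 : (Finset.univ : Finset (Fin 3)).erase 0 = {1, 2} := by decide
  have e1 : (Finset.univ : Finset (Fin 3)).erase 1 = {0, 2} := by decide
  have e2 : (Finset.univ : Finset (Fin 3)).erase 2 = {0, 1} := by decide
  have k0 := key 0
  have k1 := key 1
  have k2 := key 2
  rw [e0, Finset.prod_pair (by decide), Finset.prod_pair (by decide), mul_eq_zero,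
    mul_eq_zero] at k0
  rw [e1, Finset.prod_pair (by decide), Finset.prod_pair (by decide), mul_eq_zero,
    mul_eq_zero] at k1
  rw [e2, Finset.prod_pair (by decide), Finset.prod_pair (by decide), mul_eq_zero,
    mul_eq_zero] at k2
  have n0 := hne 0
  have n1 := hne 1
  have n2 := hne 2
  tauto

/-- A singular matrix of size two is the product of a column and a row. -/
theorem exists_eq_mul_of_det_eq_zero (N : Fin 2 → Fin 2 → ℂ)
    (h : N 0 0 * N 1 1 - N 0 1 * N 1 0 = 0) : ∃ v w : Fin 2 → ℂ, ∀ j k, N j k = v j * w k := by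
  by_cases h0 : N 0 0 = 0
  · rw [h0, zero_mul, zero_sub, neg_eq_zero, mul_eq_zero] at h
    rcases h with h | h
    · refine ⟨![0, 1], N 1, fun j k => ?_⟩
      fin_cases j <;> fin_cases k <;> simp [h0, h]
    · refine ⟨fun j => N j 1, ![0, 1], fun j k => ?_⟩
      fin_cases j <;> fin_cases k <;> simp [h0, h]
  · refine ⟨![1, N 1 0 / N 0 0], N 0, fun j k => ?_⟩
    fin_cases j <;> fin_cases k <;> simp [h0]
    field_simp
    linear_combination h

/-- The determinant of the first slice of a tensor. -/
def sliceDet {R : Type*} [CommRing R] (T : (Fin 3 → Fin 2) → R) : R :=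
  T ![0, 0, 0] * T ![0, 1, 1] - T ![0, 0, 1] * T ![0, 1, 0]

/-- The mixed determinant of the two slices of a tensor. -/
def mixedDet {R : Type*} [CommRing R] (T : (Fin 3 → Fin 2) → R) : R :=
  T ![0, 0, 0] * T ![1, 1, 1] + T ![1, 0, 0] * T ![0, 1, 1] -
    T ![0, 0, 1] * T ![1, 1, 0] - T ![1, 0, 1] * T ![0, 1, 0]

/-- Cayley's hyperdeterminant: the discriminant of the determinant of the pencil spanned by the
two slices of a tensor. -/
def hyperdet {R : Type*} [CommRing R] (T : (Fin 3 → Fin 2) → R) : R :=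
  mixedDet T ^ 2 - 4 * sliceDet T *
    (T ![1, 0, 0] * T ![1, 1, 1] - T ![1, 0, 1] * T ![1, 1, 0])

theorem exists_isGeneralSum {T : (Fin 3 → Fin 2) → ℂ} (ha : sliceDet T ≠ 0)
    (hd : hyperdet T ≠ 0) : ∃ u v, IsGeneralSum T u v := by
  obtain ⟨δ, hδ⟩ := IsAlgClosed.exists_pow_nat_eq (hyperdet T) two_pos
  have hδ0 : δ ≠ 0 := by
    rintro rfl
    exact hd (by rw [← hδ]; simp)
  -- The numbers `(mixedDet T ± δ) / (2 * sliceDet T)` are the two roots `r` of `det (T₁ - r T₀)`,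
  -- where `T₀, T₁` are the slices. At a root this matrix is singular, hence a column times a row.
  have hroot : ∀ ε : ℂ, ε ^ 2 = hyperdet T →
      ∃ v w : Fin 2 → ℂ, ∀ j k, T ![1, j, k] - (mixedDet T + ε) / (2 * sliceDet T) *
        T ![0, j, k] = v j * w k := by
    intro ε hε
    refine exists_eq_mul_of_det_eq_zero (fun j k => T ![1, j, k] - (mixedDet T + ε) /
      (2 * sliceDet T) * T ![0, j, k]) ?_
    set r := (mixedDet T + ε) / (2 * sliceDet T) with hr
    have hr' : 2 * sliceDet T * r = mixedDet T + ε := by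
      rw [hr]; field_simp
    -- Completing the square: the left side equals `(2 * sliceDet T * r - mixedDet T) ^ 2 - hyperdet
    -- T`.
    have h4 : 4 * sliceDet T * (sliceDet T * r ^ 2 - mixedDet T * r +
        (T ![1, 0, 0] * T ![1, 1, 1] - T ![1, 0, 1] * T ![1, 1, 0])) = 0 := by
      unfold hyperdet at hε
      linear_combination (2 * sliceDet T * r - mixedDet T + ε) * hr' + hε
    have h5 := (mul_eq_zero.mp h4).resolve_left (mul_ne_zero (by norm_num) ha)
    unfold sliceDet mixedDet at h5
    linear_combination h5
  obtain ⟨v₁, w₁, h₁⟩ := hroot δ hδ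
  obtain ⟨v₂, w₂, h₂⟩ := hroot (-δ) (by rw [neg_sq, hδ])
  set r₁ := (mixedDet T + δ) / (2 * sliceDet T) with hr₁
  set r₂ := (mixedDet T + -δ) / (2 * sliceDet T) with hr₂
  have hr : r₁ - r₂ ≠ 0 := by
    have : r₁ - r₂ = δ / sliceDet T := by
      rw [hr₁, hr₂]; field_simp; ring
    rw [this]
    exact div_ne_zero hδ0 ha
  have hT0 : ∀ j k, (r₁ - r₂) * T ![0, j, k] = v₂ j * w₂ k - v₁ j * w₁ k := fun j k => by
    rw [← h₁, ← h₂]; ring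
  have hT1 : ∀ j k, (r₁ - r₂) * T ![1, j, k] = r₁ * (v₂ j * w₂ k) - r₂ * (v₁ j * w₁ k) :=
    fun j k => by rw [← h₁, ← h₂]; ring
  -- The first slice is a combination of two matrices of rank at most one, so its determinant
  -- factors through these two minors; its nonvanishing gives independence in the last two factors.
  have hdet : (v₁ 0 * v₂ 1 - v₁ 1 * v₂ 0) * (w₁ 0 * w₂ 1 - w₁ 1 * w₂ 0) ≠ 0 := by
    have : (r₁ - r₂) ^ 2 * sliceDet T =
        -((v₁ 0 * v₂ 1 - v₁ 1 * v₂ 0) * (w₁ 0 * w₂ 1 - w₁ 1 * w₂ 0)) := by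
      unfold sliceDet
      linear_combination (r₁ - r₂) * T ![0, 1, 1] * hT0 0 0 +
        (v₂ 0 * w₂ 0 - v₁ 0 * w₁ 0) * hT0 1 1 - (r₁ - r₂) * T ![0, 1, 0] * hT0 0 1 -
        (v₂ 0 * w₂ 1 - v₁ 0 * w₁ 1) * hT0 1 0
    rw [← neg_ne_zero, ← this]
    exact mul_ne_zero (pow_ne_zero _ hr) ha
  -- The first factors are the coefficients of `v₁w₁` and `v₂w₂` in the two slices, read off from
  -- `hT0` and `hT1`.
  refine ⟨![![-1 / (r₁ - r₂), -r₂ / (r₁ - r₂)], v₁, w₁], ![![1 / (r₁ - r₂), r₁ / (r₁ - r₂)], v₂, w₂],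
    fun i => ?_, funext fun s => ?_⟩
  · fin_cases i
    · have : -1 / (r₁ - r₂) * (r₁ / (r₁ - r₂)) - -r₂ / (r₁ - r₂) * (1 / (r₁ - r₂)) =
          -1 / (r₁ - r₂) := by
        field_simp
        ring
      refine ne_of_eq_of_ne this (div_ne_zero (by norm_num) hr)
    · exact left_ne_zero_of_mul hdet
    · exact right_ne_zero_of_mul hdet
  · rw [eq_vec3 s]
    generalize s 0 = i, s 1 = j, s 2 = k
    simp only [Pi.add_apply, pureTensor, Fin.prod_univ_three]
    refine mul_left_cancel₀ hr ?_
    fin_cases i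
    · refine (hT0 j k).trans ?_
      simp
      field_simp
      ring
    · refine (hT1 j k).trans ?_
      simp
      field_simp
      ring

/-- The hyperplanes whose tensor has nonzero hyperdeterminant and nonsingular first slice. -/
def generalHyperplanes : Set (ProjSpace (Fin 3 → Fin 2)) :=
  {a | sliceDet (a ()).rep ≠ 0 ∧ hyperdet (a ()).rep ≠ 0}

/-- The complement is the zero set of one form, obtained by evaluating `sliceDet` and `hyperdet` on
the tensor of variables; this is why they are defined over any commutative ring. -/
theorem isZariskiOpen_generalHyperplanes : IsZariskiOpen generalHyperplanes := by
  let x : (Fin 3 → Fin 2) → CoordRing (fun _ : Unit => Fin 3 → Fin 2) :=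
    fun s => MvPolynomial.X ⟨(), s⟩
  have h2 : ∀ s t, IsMultihomogeneous (x s * x t) (Finsupp.single () 1 + Finsupp.single () 1) :=
    fun s t => (isMultihomogeneous_X _ _).mul (isMultihomogeneous_X _ _)
  have hs := (h2 ![0, 0, 0] ![0, 1, 1]).sub (h2 ![0, 0, 1] ![0, 1, 0])
  have hm := (((h2 ![0, 0, 0] ![1, 1, 1]).add (h2 ![1, 0, 0] ![0, 1, 1])).sub
    (h2 ![0, 0, 1] ![1, 1, 0])).sub (h2 ![1, 0, 1] ![0, 1, 0])
  have hs' := (h2 ![1, 0, 0] ![1, 1, 1]).sub (h2 ![1, 0, 1] ![1, 1, 0])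
  have h4 := (hs.C_mul 4).mul hs'
  rw [map_ofNat, ← two_nsmul] at h4
  have hh := (hm.pow 2).sub h4
  have hsh : ∃ d, IsMultihomogeneous (sliceDet x * hyperdet x) d := ⟨_, hs.mul hh⟩
  refine ⟨{sliceDet x * hyperdet x}, fun F hF => ?_, ?_⟩
  · rwa [Set.mem_singleton_iff.mp hF]
  · ext a
    have : evalRep a (sliceDet x * hyperdet x) = sliceDet (a ()).rep * hyperdet (a ()).rep := by
      simp [evalRep, sliceDet, hyperdet, mixedDet, x]
    simp only [generalHyperplanes, Set.mem_compl_iff, Set.mem_ofPred_eq, Set.mem_singleton_iff,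
      forall_eq, this, mul_eq_zero]
    tauto

theorem generalHyperplanes_nonempty : generalHyperplanes.Nonempty := by
  -- The slices are the identity and `diag(1, -1)`.
  let T : (Fin 3 → Fin 2) → ℂ := fun s =>
    if s = ![0, 0, 0] ∨ s = ![0, 1, 1] ∨ s = ![1, 0, 0] then 1
    else if s = ![1, 1, 1] then -1 else 0
  have hT : T ≠ 0 := fun h => by
    have := congrFun h ![0, 0, 0]
    simp [T] at this
  obtain ⟨c, hc, h⟩ := exists_rep_mk_eq T hT
  have hs : sliceDet T = 1 := by
    simp [T, sliceDet]
  have hh : hyperdet T = 4 := by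
    simp [T, hyperdet, hs, mixedDet]
  refine ⟨fun _ => Projectivization.mk ℂ T hT, ?_, ?_⟩
  · have : sliceDet (c • T) = c ^ 2 * sliceDet T := by
      simp only [sliceDet, Pi.smul_apply, smul_eq_mul]; ring
    rw [h, this, hs]
    simpa using hc
  · have : hyperdet (c • T) = c ^ 4 * hyperdet T := by
      simp only [hyperdet, sliceDet, mixedDet, Pi.smul_apply, smul_eq_mul]; ring
    rw [h, this, hh]
    simpa using hc

theorem areIsomorphic_hyperplane_inter_Seg {a : ProjSpace (Fin 3 → Fin 2)}
    {u v : Fin 3 → Fin 2 → ℂ} (h : IsGeneralSum (a ()).rep u v) :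
    AreIsomorphic (hyperplane a ∩ Seg 3) hexagonSurface :=
  (areIsomorphic_tensorLocus_hyperplane a).symm.trans h.areIsomorphic

end Tensors

/-! ### The Togliatti surface as a hyperplane section -/

section TogliattiSurface

/-- The linear embedding of projective 6-space in the space of tensors as the hyperplane with
equation `T₀₀₀ + T₁₁₁ = 0`. -/
def toTensor : Matrix (Fin 3 → Fin 2) (Fin 7) ℂ :=
  Matrix.of fun s => (![![![Pi.single 0 1, Pi.single 4 (-1)], ![Pi.single 5 (-1), Pi.single 3 1]],
    ![![Pi.single 2 (-1), Pi.single 6 1], ![Pi.single 1 1, Pi.single 0 (-1)]]] :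
    Fin 2 → Fin 2 → Fin 2 → Fin 7 → ℂ) (s 0) (s 1) (s 2)

/-- The projection of the space of tensors on the coordinates of projective 6-space. -/
def ofTensor : Matrix (Fin 7) (Fin 3 → Fin 2) ℂ :=
  Matrix.of ![Pi.single ![0, 0, 0] 1, Pi.single ![1, 1, 0] 1, Pi.single ![1, 0, 0] (-1),
    Pi.single ![0, 1, 1] 1, Pi.single ![0, 0, 1] (-1), Pi.single ![0, 1, 0] (-1),
    Pi.single ![1, 0, 1] 1]

theorem toTensor_mulVec (y : Fin 7 → ℂ) :
    toTensor *ᵥ y = fun s => (![![![y 0, -y 4], ![-y 5, y 3]], ![![-y 2, y 6], ![y 1, -y 0]]] :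
      Fin 2 → Fin 2 → Fin 2 → ℂ) (s 0) (s 1) (s 2) := by
  funext s
  simp only [toTensor, Matrix.mulVec, Matrix.of_apply]
  generalize s 0 = i, s 1 = j, s 2 = k
  fin_cases i <;> fin_cases j <;> fin_cases k <;> simp

theorem ofTensor_mulVec (T : (Fin 3 → Fin 2) → ℂ) :
    ofTensor *ᵥ T = ![T ![0, 0, 0], T ![1, 1, 0], -T ![1, 0, 0], T ![0, 1, 1], -T ![0, 0, 1],
      -T ![0, 1, 0], T ![1, 0, 1]] := by
  funext m
  fin_cases m <;> simp [ofTensor, Matrix.mulVec]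

theorem ofTensor_mulVec_toTensor_mulVec (y : Fin 7 → ℂ) :
    ofTensor *ᵥ (toTensor *ᵥ y) = y := by
  rw [ofTensor_mulVec, toTensor_mulVec]
  funext m
  fin_cases m <;> simp

theorem toTensor_mulVec_ofTensor_mulVec {T : (Fin 3 → Fin 2) → ℂ}
    (hT : T ![0, 0, 0] + T ![1, 1, 1] = 0) : toTensor *ᵥ (ofTensor *ᵥ T) = T := by
  rw [ofTensor_mulVec, toTensor_mulVec]
  funext s
  conv_rhs => rw [eq_vec3 s]
  generalize s 0 = i, s 1 = j, s 2 = k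
  fin_cases i <;> fin_cases j <;> fin_cases k <;> simp
  linear_combination -hT

/-- The three factors are coordinates of the lines joining `x` to the coordinate points. The signs
in `toTensor` are chosen for this identity. -/
theorem toTensor_mulVec_togliattiCubics (x : Fin 3 → ℂ) :
    toTensor *ᵥ togliattiCubics x =
      pureTensor ![![x 1, -x 0], ![x 2, -x 1], ![x 0, -x 2]] := by
  rw [toTensor_mulVec]
  funext s
  simp only [pureTensor, Fin.prod_univ_three]
  generalize s 0 = i, s 1 = j, s 2 = k
  fin_cases i <;> fin_cases j <;> fin_cases k <;> 
    simp [togliattiCubics, -mul_eq_mul_left_iff, -mul_eq_mul_right_iff] <;> ring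

/-- The quadratic relations between the coordinates of a decomposable tensor. -/
def IsSegreTensor (T : (Fin 3 → Fin 2) → ℂ) : Prop :=
  ∀ a b c a' b' c', T ![a, b, c] * T ![a', b', c'] = T ![a', b, c] * T ![a, b', c'] ∧
    T ![a, b, c] * T ![a', b', c'] = T ![a, b, c'] * T ![a', b', c]

theorem isSegreTensor_pureTensor (v : Fin 3 → Fin 2 → ℂ) : IsSegreTensor (pureTensor v) := by
  intro a b c a' b' c'
  simp only [pureTensor, Fin.prod_univ_three, Matrix.cons_val]
  constructor <;> ring

theorem IsSegreTensor.smul {T : (Fin 3 → Fin 2) → ℂ} (h : IsSegreTensor T) (e : ℂ) :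
    IsSegreTensor (e • T) := by
  intro a b c a' b' c'
  obtain ⟨h1, h2⟩ := h a b c a' b' c'
  simp only [Pi.smul_apply, smul_eq_mul]
  exact ⟨by linear_combination e ^ 2 * h1, by linear_combination e ^ 2 * h2⟩

/-- The factors are the three rows of entries through a nonzero entry `T ![a, b, c]`. Applying the
quadratic relations twice, the product of one entry from each row is `T ![a, b, c] ^ 2 * T ![a', b',
c']`. -/
theorem IsSegreTensor.exists_eq {T : (Fin 3 → Fin 2) → ℂ} (h : IsSegreTensor T) (hT : T ≠ 0) :
    ∃ (e : ℂ) (v : Fin 3 → Fin 2 → ℂ), (∀ i, v i ≠ 0) ∧ T = e • pureTensor v := by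
  obtain ⟨s, hs⟩ := Function.ne_iff.mp hT
  rw [eq_vec3 s] at hs
  generalize s 0 = a, s 1 = b, s 2 = c at hs
  simp only [Pi.zero_apply] at hs
  refine ⟨(T ![a, b, c] ^ 2)⁻¹, ![fun k => T ![k, b, c], fun k => T ![a, k, c],
    fun k => T ![a, b, k]], fun i => ?_, funext fun t => ?_⟩
  · fin_cases i
    · exact Function.ne_iff.mpr ⟨a, hs⟩
    · exact Function.ne_iff.mpr ⟨b, hs⟩
    · exact Function.ne_iff.mpr ⟨c, hs⟩
  · rw [eq_vec3 t]
    generalize t 0 = a', t 1 = b', t 2 = c'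
    rw [Pi.smul_apply, smul_eq_mul, eq_inv_mul_iff_mul_eq₀ (pow_ne_zero _ hs)]
    simp only [pureTensor, Fin.prod_univ_three, Matrix.cons_val]
    have h1 := (h a' b c a b' c).1
    have h2 := (h a b c a' b' c').2
    linear_combination -T ![a, b, c'] * h1 + T ![a, b, c] * h2

theorem isZariskiClosed_setOf_isSegreTensor :
    IsZariskiClosed {P : ProjSpace (Fin 7) | IsSegreTensor (toTensor *ᵥ (P ()).rep)} := by
  let l : (Fin 3 → Fin 2) → CoordRing (fun _ : Unit => Fin 7) := fun s =>
    linearPoly () (toTensor s)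
  have hl : ∀ s t, IsMultihomogeneous (l s * l t) (Finsupp.single () 1 + Finsupp.single () 1) :=
    fun s t => (isMultihomogeneous_linearPoly _ _).mul (isMultihomogeneous_linearPoly _ _)
  have hev : ∀ (P : ProjSpace (Fin 7)) s s' t t', evalRep P (l s * l s' - l t * l t') =
      (toTensor *ᵥ (P ()).rep) s * (toTensor *ᵥ (P ()).rep) s' -
        (toTensor *ᵥ (P ()).rep) t * (toTensor *ᵥ (P ()).rep) t' := by
    intro P s s' t t'
    rw [evalRep, map_sub, map_mul, map_mul]
    simp only [l, eval_linearPoly]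
    rfl
  refine ⟨{F | ∃ a b c a' b' c',
    F = l ![a, b, c] * l ![a', b', c'] - l ![a', b, c] * l ![a, b', c'] ∨
    F = l ![a, b, c] * l ![a', b', c'] - l ![a, b, c'] * l ![a', b', c]}, ?_, ?_⟩
  · rintro F ⟨a, b, c, a', b', c', rfl | rfl⟩
    · exact ⟨_, (hl _ _).sub (hl _ _)⟩
    · exact ⟨_, (hl _ _).sub (hl _ _)⟩
  · ext P
    constructor
    · rintro h F ⟨a, b, c, a', b', c', rfl | rfl⟩
      · rw [hev, (h a b c a' b' c').1, sub_self]
      · rw [hev, (h a b c a' b' c').2, sub_self]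
    · intro h a b c a' b' c'
      have h1 := h _ ⟨a, b, c, a', b', c', Or.inl rfl⟩
      have h2 := h _ ⟨a, b, c, a', b', c', Or.inr rfl⟩
      rw [hev] at h1 h2
      exact ⟨sub_eq_zero.mp h1, sub_eq_zero.mp h2⟩

theorem isSegreTensor_of_mem_togliattiSurface {P : ProjSpace (Fin 7)}
    (hP : P ∈ togliattiSurface) : IsSegreTensor (toTensor *ᵥ (P ()).rep) := by
  refine zariskiClosure_subset isZariskiClosed_setOf_isSegreTensor ?_ hP
  rintro _ ⟨x, hx, rfl⟩
  obtain ⟨c, -, h⟩ := exists_rep_mk_eq _ hx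
  rw [Set.mem_ofPred_eq, h, Matrix.mulVec_smul, toTensor_mulVec_togliattiCubics]
  exact (isSegreTensor_pureTensor _).smul c

-- For `s ≠ 0` the point given by `V s` is a value of the cubics. At `s = 0` the cubics vanish at `x
-- 0`, and the point is only a limit of values.
open Filter Topology in
theorem mem_togliattiSurface_of_curve {V : ℂ → Fin 3 → Fin 2 → ℂ} {x : ℂ → Fin 3 → ℂ}
    (hV : ∀ i k, Continuous fun s => V s i k) (hV0 : ∀ s i, V s i ≠ 0)
    (hV1 : ∀ s, V s 0 0 * V s 1 0 * V s 2 0 + V s 0 1 * V s 1 1 * V s 2 1 = 0)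
    (hx : ∀ s, togliattiCubics (x s) = s • ofTensor *ᵥ pureTensor (V s))
    {P : ProjSpace (Fin 7)} {c r : ℂ} (hP : (P ()).rep = c • ofTensor *ᵥ pureTensor (V r)) :
    P ∈ togliattiSurface := by
  have hne : ∀ s, ofTensor *ᵥ pureTensor (V s) ≠ 0 := by
    intro s h
    refine pureTensor_ne_zero (hV0 s) ?_
    rw [← toTensor_mulVec_ofTensor_mulVec (T := pureTensor (V s)), h, Matrix.mulVec_zero]
    simpa [pureTensor, Fin.prod_univ_three] using hV1 s
  have hPr : P = point (fun _ : Unit => ofTensor *ᵥ pureTensor (V r)) fun _ => hne r := by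
    funext u
    rw [← (P u).mk_rep]
    exact (Projectivization.mk_eq_mk_iff' ℂ _ _ _ _).mpr ⟨c, hP.symm⟩
  rw [hPr]
  refine point_mem_zariskiClosure (γ := fun s _ => ofTensor *ᵥ pureTensor (V s)) ?_ _ ?_
  · refine continuous_pi fun _ => continuous_pi fun m => ?_
    change Continuous fun s => ∑ t, ofTensor m t * ∏ i, V s i (t i)
    refine continuous_finsetSum _ fun s _ => continuous_const.mul ?_
    exact continuous_finsetProd _ fun i _ => hV i _
  · have h0 : ∀ᶠ s in 𝓝[≠] r, s ≠ 0 := by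
      by_cases hr : r = 0
      · rw [hr]; exact self_mem_nhdsWithin
      · exact nhdsWithin_le_nhds (isOpen_ne.mem_nhds hr)
    filter_upwards [h0] with s hs
    have hxs : togliattiCubics (x s) ≠ 0 := by
      rw [hx s]; exact smul_ne_zero hs (hne s)
    refine ⟨fun _ => hne s, x s, hxs, funext fun _ => ?_⟩
    refine (Projectivization.mk_eq_mk_iff' ℂ _ _ _ _).mpr ⟨s⁻¹, ?_⟩
    rw [hx s, inv_smul_smul₀ hs]

/-- The points with `a 0 ≠ 0` and `b 1 ≠ 0` on the hypersurface `a₀b₀c₀ + a₁b₁c₁ = 0`. -/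
theorem exists_parameter {a b c : Fin 2 → ℂ} (ha : a 0 ≠ 0) (hb : b 1 ≠ 0) (hc : c ≠ 0)
    (h : a 0 * b 0 * c 0 + a 1 * b 1 * c 1 = 0) :
    ∃ r, a = a 0 • ![1, -(r * c 0)] ∧ b = b 1 • ![r * c 1, 1] := by
  -- Divided by `a 0 * b 1`, the equation says that `(-a 1 / a 0, b 0 / b 1)` is proportional to
  -- `c`; `r` is the ratio.
  have key : ∃ r, a 1 = a 0 * -(r * c 0) ∧ b 0 = b 1 * (r * c 1) := by
    by_cases h0 : c 0 = 0
    · have h1 : c 1 ≠ 0 := fun h1 => hc (funext fun k => by fin_cases k <;> assumption)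
      have ha1 : a 1 = 0 := by simpa [h0, hb, h1] using h
      exact ⟨b 0 / (b 1 * c 1), by rw [ha1, h0]; ring, by field_simp⟩
    · refine ⟨-a 1 / (a 0 * c 0), by field_simp, ?_⟩
      field_simp
      linear_combination h
  obtain ⟨r, h1, h2⟩ := key
  refine ⟨r, funext fun k => ?_, funext fun k => ?_⟩
  · fin_cases k
    · simp
    · simpa using h1
  · fin_cases k
    · simpa using h2
    · simp

/-- Three cyclically permuted charts cover the model. They serve twice: for parametrizing the
Togliatti surface, and for finding two distinct lines among three concurrent ones. -/
theorem exists_ne_zero_of_hexagon {v : Fin 3 → Fin 2 → ℂ} (hv : ∀ i, v i ≠ 0)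
    (h : v 0 0 * v 1 0 * v 2 0 + v 0 1 * v 1 1 * v 2 1 = 0) :
    (v 0 0 ≠ 0 ∧ v 1 1 ≠ 0) ∨ (v 1 0 ≠ 0 ∧ v 2 1 ≠ 0) ∨ (v 2 0 ≠ 0 ∧ v 0 1 ≠ 0) := by
  have hne : ∀ i, v i 0 = 0 → v i 1 = 0 → False := fun i h0 h1 =>
    hv i (funext fun k => by fin_cases k <;> assumption)
  have n0 := hne 0
  have n1 := hne 1
  have n2 := hne 2
  by_contra! hcon
  by_cases h0 : v 0 0 = 0
  · simp only [h0, zero_mul, zero_add, mul_eq_zero] at h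
    tauto
  · have h11 := hcon.1 h0
    simp only [h11, mul_zero, zero_mul, add_zero, mul_eq_zero] at h
    tauto

theorem mem_togliattiSurface_of_pureTensor {v : Fin 3 → Fin 2 → ℂ} (hv : ∀ i, v i ≠ 0)
    (h : v 0 0 * v 1 0 * v 2 0 + v 0 1 * v 1 1 * v 2 1 = 0) {P : ProjSpace (Fin 7)} {c : ℂ}
    (hP : (P ()).rep = c • ofTensor *ᵥ pureTensor v) : P ∈ togliattiSurface := by
  have hcases := exists_ne_zero_of_hexagon hv h
  have hsmul : ∀ (e : Fin 3 → ℂ) (w : Fin 3 → Fin 2 → ℂ), v = (fun i => e i • w i) →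
      (P ()).rep = (c * ∏ i, e i) • ofTensor *ᵥ pureTensor w := by
    intro e w hw
    rw [hP, hw, pureTensor_smul, Matrix.mulVec_smul, smul_smul]
  have hne1 : ∀ z : ℂ, ![1, z] ≠ 0 := fun z h => one_ne_zero (congrFun h 0)
  have hne2 : ∀ z : ℂ, ![z, 1] ≠ 0 := fun z h => one_ne_zero (congrFun h 1)
  rcases hcases with ⟨h0, h1⟩ | ⟨h0, h1⟩ | ⟨h0, h1⟩
  · obtain ⟨r, ha, hb⟩ := exists_parameter h0 h1 (hv 2) h
    -- For this `x` the factors `(x₁,-x₀)`, `(x₂,-x₁)`, `(x₀,-x₂)` are `-V 0`, `V 1` and `-s • v 2`,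
    -- whence the factor `s`. The other two cases are cyclic shifts.
    refine mem_togliattiSurface_of_curve
      (V := fun s => ![![1, -(s * v 2 0)], ![s * v 2 1, 1], v 2])
      (x := fun s => ![-(s * v 2 0), -1, s * v 2 1]) (r := r) ?_ ?_ ?_ ?_
      (hsmul ![v 0 0, v 1 1, 1] _ ?_)
    · intro i k
      fin_cases i <;> fin_cases k <;> simp <;> fun_prop
    · intro s i
      fin_cases i
      · exact hne1 _
      · exact hne2 _
      · exact hv 2
    · intro s
      simp
      ring
    · intro s
      rw [ofTensor_mulVec]
      funext m
      fin_cases m <;> simp [togliattiCubics, pureTensor, Fin.prod_univ_three] <;> ring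
    · funext i
      fin_cases i
      · exact ha
      · exact hb
      · exact (one_smul ℂ (v 2)).symm
  · obtain ⟨r, ha, hb⟩ := exists_parameter h0 h1 (hv 0) (by linear_combination h)
    refine mem_togliattiSurface_of_curve
      (V := fun s => ![v 0, ![1, -(s * v 0 0)], ![s * v 0 1, 1]])
      (x := fun s => ![s * v 0 1, -(s * v 0 0), -1]) (r := r) ?_ ?_ ?_ ?_
      (hsmul ![1, v 1 0, v 2 1] _ ?_)
    · intro i k
      fin_cases i <;> fin_cases k <;> simp <;> fun_prop
    · intro s i
      fin_cases i
      · exact hv 0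
      · exact hne1 _
      · exact hne2 _
    · intro s
      simp
      ring
    · intro s
      rw [ofTensor_mulVec]
      funext m
      fin_cases m <;> simp [togliattiCubics, pureTensor, Fin.prod_univ_three] <;> ring
    · funext i
      fin_cases i
      · exact (one_smul ℂ (v 0)).symm
      · exact ha
      · exact hb
  · obtain ⟨r, ha, hb⟩ := exists_parameter h0 h1 (hv 1) (by linear_combination h)
    refine mem_togliattiSurface_of_curve
      (V := fun s => ![![s * v 1 1, 1], v 1, ![1, -(s * v 1 0)]])
      (x := fun s => ![-1, s * v 1 1, -(s * v 1 0)]) (r := r) ?_ ?_ ?_ ?_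
      (hsmul ![v 0 1, 1, v 2 0] _ ?_)
    · intro i k
      fin_cases i <;> fin_cases k <;> simp <;> fun_prop
    · intro s i
      fin_cases i
      · exact hne2 _
      · exact hv 1
      · exact hne1 _
    · intro s
      simp
      ring
    · intro s
      rw [ofTensor_mulVec]
      funext m
      fin_cases m <;> simp [togliattiCubics, pureTensor, Fin.prod_univ_three] <;> ring
    · funext i
      fin_cases i
      · exact hb
      · exact (one_smul ℂ (v 1)).symm
      · exact ha

theorem exists_areIsomorphic_togliattiSurface_hyperplane :
    ∃ (a : ProjSpace (Fin 3 → Fin 2)) (u v : Fin 3 → Fin 2 → ℂ), IsGeneralSum (a ()).rep u v ∧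
      AreIsomorphic togliattiSurface (hyperplane a ∩ Seg 3) := by
  let T : (Fin 3 → Fin 2) → ℂ := pureTensor (fun _ => ![1, 0]) + pureTensor fun _ => ![0, 1]
  have hT : T ≠ 0 := fun h => by
    have := congrFun h ![0, 0, 0]
    simp [T, pureTensor, Fin.prod_univ_three] at this
  obtain ⟨c, hc, h⟩ := exists_rep_mk_eq T hT
  let a : ProjSpace (Fin 3 → Fin 2) := fun _ => Projectivization.mk ℂ T hT
  have ha : ∀ w : (Fin 3 → Fin 2) → ℂ, ∑ s, (a ()).rep s * w s = 0 ↔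
      w ![0, 0, 0] + w ![1, 1, 1] = 0 := by
    intro w
    change (a ()).rep ⬝ᵥ w = 0 ↔ _
    rw [show (a ()).rep = c • T from h, smul_dotProduct, smul_eq_zero_iff_right hc, dotProduct,
      sum_fin_three_fun]
    simp [T, pureTensor, Fin.prod_univ_three]
  -- The chosen representative of `a` is `c • T`; the scalar is absorbed in the first factors.
  refine ⟨a, ![![c, 0], ![1, 0], ![1, 0]], ![![0, c], ![0, 1], ![0, 1]], ⟨fun i => ?_, ?_⟩, ?_⟩
  · fin_cases i <;> simp [hc]
  · refine Eq.trans h (funext fun s => ?_)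
    simp only [T, Pi.smul_apply, Pi.add_apply, pureTensor, Fin.prod_univ_three]
    generalize s 0 = i, s 1 = j, s 2 = k
    fin_cases i <;> fin_cases j <;> fin_cases k <;> simp
  · refine areIsomorphic_of_linear (fun _ => toTensor) (fun _ => ofTensor)
      (fun P _ _ => ofTensor_mulVec_toTensor_mulVec _)
      (fun Q hQ _ => toTensor_mulVec_ofTensor_mulVec ((ha _).mp hQ.1)) (fun P hP h0 => ?_)
      fun Q hQ h0 => ?_
    · obtain ⟨e, he, hr⟩ := exists_rep_point_eq _ h0
      constructor
      · refine (ha _).mpr ?_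
        rw [hr, toTensor_mulVec]
        simp
      · obtain ⟨d, v, hv, hd⟩ := (isSegreTensor_of_mem_togliattiSurface hP).exists_eq (h0 ())
        exact mem_Seg_iff.mpr ⟨e () * d, v, hv, by rw [hr, hd, smul_smul]⟩
    · obtain ⟨e, he, hr⟩ := exists_rep_point_eq _ h0
      obtain ⟨d, v, hv, hd⟩ := mem_Seg_iff.mp hQ.2
      have hd0 : d ≠ 0 := by
        rintro rfl
        exact (Q ()).rep_nonzero (by rw [hd, zero_smul])
      refine mem_togliattiSurface_of_pureTensor hv ?_ (c := e () * d)
        (by rw [hr, hd, Matrix.mulVec_smul, smul_smul])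
      have := (ha _).mp hQ.1
      rw [hd] at this
      simp only [Pi.smul_apply, ← smul_add, smul_eq_zero_iff_right hd0] at this
      simpa [pureTensor, Fin.prod_univ_three] using this

theorem areIsomorphic_togliattiSurface_hexagonSurface :
    AreIsomorphic togliattiSurface hexagonSurface := by
  obtain ⟨a, u, v, h, hiso⟩ := exists_areIsomorphic_togliattiSurface_hyperplane
  exact hiso.trans (areIsomorphic_hyperplane_inter_Seg h)

end TogliattiSurface

/-! ### The equations of the blow-up of the plane -/

section BlowUp

theorem orthogonal_iff_rep {x y : ℙ ℂ (Fin 3 → ℂ)} : x.orthogonal y ↔ x.rep ⬝ᵥ y.rep = 0 := by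
  conv_lhs => rw [← x.mk_rep, ← y.mk_rep]
  exact Projectivization.orthogonal_mk x.rep_nonzero y.rep_nonzero

theorem crossProduct_rep_ne_zero {x y : ℙ ℂ (Fin 3 → ℂ)} (h : x ≠ y) :
    crossProduct x.rep y.rep ≠ 0 := by
  intro h0
  rw [← Projectivization.mk_eq_mk_iff_crossProduct_eq_zero x.rep_nonzero y.rep_nonzero,
    x.mk_rep, y.mk_rep] at h0
  exact h h0

theorem cross_eq_mk_crossProduct_rep {x y : ℙ ℂ (Fin 3 → ℂ)} (h : x ≠ y) :
    x.cross y = Projectivization.mk ℂ _ (crossProduct_rep_ne_zero h) := by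
  conv_lhs => rw [← x.mk_rep, ← y.mk_rep]
  exact Projectivization.cross_mk_of_cross_ne_zero _ _ (crossProduct_rep_ne_zero h)

/-- The line joining two distinct points is the only line containing both. -/
theorem eq_cross_of_dotProduct_eq_zero {x y l : ℙ ℂ (Fin 3 → ℂ)} (h : x ≠ y)
    (hx : l.rep ⬝ᵥ x.rep = 0) (hy : l.rep ⬝ᵥ y.rep = 0) : l = x.cross y := by
  rw [cross_eq_mk_crossProduct_rep h, ← l.mk_rep,
    Projectivization.mk_eq_mk_iff_crossProduct_eq_zero]
  simp only [dotProduct, Fin.sum_univ_three] at hx hy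
  funext k
  simp only [cross_apply]
  fin_cases k <;> simp
  · linear_combination x.rep 0 * hy - y.rep 0 * hx
  · linear_combination x.rep 1 * hy - y.rep 1 * hx
  · linear_combination x.rep 2 * hy - y.rep 2 * hx

open ComplexOrder in
/-- Every line through a point joins it to some point. -/
theorem exists_crossProduct_eq_smul {a l : Fin 3 → ℂ} (ha : a ≠ 0) (h : l ⬝ᵥ a = 0) :
    ∃ (q : Fin 3 → ℂ) (c : ℂ), c ≠ 0 ∧ crossProduct q a = c • l := by
  -- By the triple product formula, `(ā × l) × a = (ā · a) l - (l · a) ā`. The conjugate is needed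
  -- because `a · a` may vanish.
  refine ⟨crossProduct (star a) l, star a ⬝ᵥ a, ?_, ?_⟩
  · rwa [ne_eq, dotProduct_star_self_eq_zero]
  · simp only [dotProduct, Fin.sum_univ_three] at h
    funext k
    simp only [cross_apply, dotProduct, Fin.sum_univ_three]
    fin_cases k <;> simp
    · linear_combination -starRingEnd ℂ (a 0) * h
    · linear_combination -starRingEnd ℂ (a 1) * h
    · linear_combination -starRingEnd ℂ (a 2) * h

variable {κ : Type} (p : κ → ℙ ℂ (Fin 3 → ℂ))

/-- The points `P` such that each line `P (some k)` joins the point `P none` and `p k`. -/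
def incidence : Set (MultiProj (fun _ : Option κ => Fin 3)) :=
  {P | ∀ k, (P (some k)).rep ⬝ᵥ (p k).rep = 0 ∧ (P (some k)).rep ⬝ᵥ (P none).rep = 0}

theorem isZariskiClosed_incidence : IsZariskiClosed (incidence p) := by
  let F : κ → CoordRing (fun _ : Option κ => Fin 3) := fun k => linearPoly (some k) (p k).rep
  let G : κ → CoordRing (fun _ : Option κ => Fin 3) := fun k =>
    ∑ j : Fin 3, MvPolynomial.X ⟨some k, j⟩ * MvPolynomial.X ⟨none, j⟩
  have hF : ∀ P k, evalRep P (F k) = (P (some k)).rep ⬝ᵥ (p k).rep := fun P k => by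
    rw [evalRep_linearPoly, dotProduct_comm]
  have hG : ∀ P k, evalRep P (G k) = (P (some k)).rep ⬝ᵥ (P none).rep := fun P k => by
    simp [evalRep, G, dotProduct]
  refine ⟨Set.range F ∪ Set.range G, ?_, ?_⟩
  · rintro _ (⟨k, rfl⟩ | ⟨k, rfl⟩)
    · exact ⟨_, isMultihomogeneous_linearPoly _ _⟩
    · exact ⟨_, MvPolynomial.IsWeightedHomogeneous.sum _ _ _ fun j _ =>
        (isMultihomogeneous_X (σ := fun _ : Option κ => Fin 3) (some k) j).mul
          (isMultihomogeneous_X (σ := fun _ : Option κ => Fin 3) none j)⟩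
  · ext P
    constructor
    · rintro h _ (⟨k, rfl⟩ | ⟨k, rfl⟩)
      · rw [hF, (h k).1]
      · rw [hG, (h k).2]
    · intro h k
      rw [← hF, ← hG]
      exact ⟨h _ (Or.inl ⟨k, rfl⟩), h _ (Or.inr ⟨k, rfl⟩)⟩

variable {p}

-- Away from the centres the incidence relations determine the lines. Over `p m`, the line `P (some
-- m)` gives a direction `q`, and the curve `a + s • q` approaches `p m` along it. The line to `p m`
-- stays constant, while the lines to the other `p k` converge to those from `p m`, which are
-- defined by injectivity. Finiteness of `κ` lets one punctured neighbourhood serve all `k`.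
open Filter Topology in
theorem blowUpPlane_eq_incidence [Finite κ] (hp : Function.Injective p) :
    blowUpPlane p = incidence p := by
  classical
  refine Set.Subset.antisymm (zariskiClosure_subset (isZariskiClosed_incidence p) ?_) ?_
  · intro P hP k
    rw [(hP k).2, ← orthogonal_iff_rep, ← orthogonal_iff_rep]
    exact ⟨Projectivization.cross_orthogonal_right (hP k).1,
      Projectivization.cross_orthogonal_left (hP k).1⟩
  · intro P hP
    by_cases hx : ∀ k, P none ≠ p k
    · exact subset_zariskiClosure _ fun k =>
        ⟨hx k, eq_cross_of_dotProduct_eq_zero (hx k) (hP k).2 (hP k).1⟩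
    push Not at hx
    obtain ⟨m, hm⟩ := hx
    set a := (p m).rep with ha
    obtain ⟨q, c, hc, hq⟩ := exists_crossProduct_eq_smul (p m).rep_nonzero (hP m).1
    have hq0 : crossProduct q a ≠ 0 := by
      rw [hq]
      exact smul_ne_zero hc (P (some m)).rep_nonzero
    let γ : ℂ → ∀ _ : Option κ, Fin 3 → ℂ := fun s i => i.elim (a + s • q) fun k =>
      if k = m then crossProduct q a else crossProduct (a + s • q) (p k).rep
    have hγ : Continuous γ := by
      refine continuous_pi fun i => ?_
      cases i with
      | none => exact continuous_const.add (continuous_id.smul continuous_const)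
      | some k =>
        by_cases hk : k = m
        · simp only [γ, Option.elim_some, hk, if_true]
          exact continuous_const
        · simp only [γ, Option.elim_some, hk, if_false, map_add, map_smul, LinearMap.add_apply,
            LinearMap.smul_apply]
          exact continuous_const.add (continuous_id.smul continuous_const)
    have h0 : ∀ i, γ 0 i ≠ 0 := by
      intro i
      cases i with
      | none => simpa [γ] using (p m).rep_nonzero
      | some k =>
        by_cases hk : k = m
        · simpa only [γ, Option.elim_some, hk, if_true] using hq0
        · simp only [γ, Option.elim_some, hk, if_false, zero_smul, add_zero]
          exact crossProduct_rep_ne_zero fun h => hk (hp h).symm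
    have hP0 : P = point (γ 0) h0 := by
      funext i
      cases i with
      | none =>
        rw [hm, ← (p m).mk_rep]
        refine (Projectivization.mk_eq_mk_iff' ℂ _ _ _ _).mpr ⟨1, ?_⟩
        simp [γ, ha]
      | some k =>
        by_cases hk : k = m
        · subst hk
          rw [← (P (some k)).mk_rep]
          refine (Projectivization.mk_eq_mk_iff' ℂ _ _ _ _).mpr ⟨c⁻¹, ?_⟩
          simp only [γ, Option.elim_some, if_true]
          exact (congrArg (c⁻¹ • ·) hq).trans (inv_smul_smul₀ hc _)
        · have hmk : p m ≠ p k := fun h => hk (hp h).symm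
          rw [eq_cross_of_dotProduct_eq_zero hmk (hm ▸ (hP k).2) (hP k).1,
            cross_eq_mk_crossProduct_rep hmk]
          refine (Projectivization.mk_eq_mk_iff' ℂ _ _ _ _).mpr ⟨1, ?_⟩
          simp [γ, ha, hk]
    rw [hP0]
    refine point_mem_zariskiClosure hγ h0 ?_
    have hev : ∀ᶠ s in 𝓝[≠] (0 : ℂ), ∀ k, γ s (some k) ≠ 0 := by
      refine eventually_all.mpr fun k => nhdsWithin_le_nhds ?_
      exact ((continuous_apply (some k)).comp hγ).continuousAt.eventually_ne (h0 (some k))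
    filter_upwards [hev, self_mem_nhdsWithin] with s hs hs0
    have hcross : ∀ k, crossProduct (a + s • q) (p k).rep ≠ 0 ∧
        ∃ e : ℂ, e • crossProduct (a + s • q) (p k).rep = γ s (some k) := by
      intro k
      by_cases hk : k = m
      · subst hk
        have : crossProduct (a + s • q) (p k).rep = s • crossProduct q a := by
          simp only [map_add, map_smul, LinearMap.add_apply, LinearMap.smul_apply, ← ha,
            cross_self, zero_add]
        refine ⟨?_, s⁻¹, ?_⟩
        · rw [this]; exact smul_ne_zero hs0 hq0
        · rw [this, inv_smul_smul₀ hs0]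
          simp [γ]
      · have := hs k
        simp only [γ, Option.elim_some, hk, if_false] at this
        exact ⟨this, 1, by simp [γ, hk]⟩
    have hne : a + s • q ≠ 0 := fun h => (hcross m).1 (by rw [h, map_zero, LinearMap.zero_apply])
    have hs' : ∀ i, γ s i ≠ 0 := by
      intro i
      cases i with
      | none => exact hne
      | some k => exact hs k
    refine ⟨hs', fun k => ?_⟩
    obtain ⟨hk, e, he⟩ := hcross k
    constructor
    · intro h
      have h' : Projectivization.mk ℂ (a + s • q) hne = Projectivization.mk ℂ _ (p k).rep_nonzero :=
        Eq.trans h (p k).mk_rep.symm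
      rw [Projectivization.mk_eq_mk_iff_crossProduct_eq_zero] at h'
      exact hk h'
    · have : (Projectivization.mk ℂ (a + s • q) hne).cross (p k) = Projectivization.mk ℂ _ hk := by
        conv_lhs => rw [← (p k).mk_rep]
        exact Projectivization.cross_mk_of_cross_ne_zero _ _ hk
      refine Eq.trans ?_ this.symm
      exact (Projectivization.mk_eq_mk_iff' ℂ _ _ _ _).mpr ⟨e, he⟩

end BlowUp

/-! ### The blow-up of the plane in three points as a hypersurface in the product of three lines -/

section Hexagon

/-- The equations of the blow-up at the coordinate points. -/
def coordinateIncidence : Set (MultiProj (fun _ : Option (Fin 3) => Fin 3)) :=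
  {P | ∀ k, (P (some k)).rep k = 0 ∧ (P (some k)).rep ⬝ᵥ (P none).rep = 0}

theorem point_mem_coordinateIncidence_iff (w : Option (Fin 3) → Fin 3 → ℂ) (hw : ∀ i, w i ≠ 0) :
    point w hw ∈ coordinateIncidence ↔ ∀ k, w (some k) k = 0 ∧ w (some k) ⬝ᵥ w none = 0 := by
  obtain ⟨c, hc, h⟩ := exists_rep_point_eq w hw
  simp only [coordinateIncidence, Set.mem_ofPred_eq, h, Pi.smul_apply, dotProduct_smul,
    smul_dotProduct, smul_eq_zero_iff_right (hc _)]

/-- Let `M` have the `p k` as rows. Points are transformed by `(Mᵀ)⁻¹`, which sends `p k` to the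
`k`-th coordinate point, and lines contragrediently by `M`, so that incidence is preserved. -/
theorem areIsomorphic_incidence_coordinateIncidence {p : Fin 3 → ℙ ℂ (Fin 3 → ℂ)}
    (hp : Projectivization.Independent p) :
    AreIsomorphic (incidence p) coordinateIncidence := by
  let M : Matrix (Fin 3) (Fin 3) ℂ := Matrix.of fun k => (p k).rep
  have hM : IsUnit M := by
    rw [← Matrix.linearIndependent_rows_iff_isUnit]
    exact Projectivization.independent_iff.mp hp
  have hdet : IsUnit M.det := (Matrix.isUnit_iff_isUnit_det M).mp hM
  have hdet' : IsUnit Mᵀ.det := by rwa [Matrix.det_transpose]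
  have hMk : ∀ l k, (M *ᵥ l) k = l ⬝ᵥ (p k).rep := fun l k => dotProduct_comm _ _
  have hdot : ∀ l x, (M *ᵥ l) ⬝ᵥ x = l ⬝ᵥ (Mᵀ *ᵥ x) := fun l x => by
    rw [Matrix.mulVec_transpose, dotProduct_comm l, ← Matrix.dotProduct_mulVec, dotProduct_comm]
  have hinv : ∀ N : Matrix (Fin 3) (Fin 3) ℂ, IsUnit N.det → ∀ w,
      N⁻¹ *ᵥ (N *ᵥ w) = w ∧ N *ᵥ (N⁻¹ *ᵥ w) = w := fun N hN w => by
    rw [Matrix.mulVec_mulVec, Matrix.mulVec_mulVec, Matrix.nonsing_inv_mul _ hN,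
      Matrix.mul_nonsing_inv _ hN, Matrix.one_mulVec]
    exact ⟨rfl, rfl⟩
  refine areIsomorphic_of_linear (fun i => i.elim (Mᵀ)⁻¹ fun _ => M)
    (fun i => i.elim Mᵀ fun _ => M⁻¹) (fun P _ i => ?_) (fun Q _ i => ?_) (fun P hP h0 => ?_)
    fun Q hQ h0 => ?_
  · cases i
    · exact (hinv _ hdet' _).2
    · exact (hinv _ hdet _).1
  · cases i
    · exact (hinv _ hdet' _).1
    · exact (hinv _ hdet _).2
  · rw [point_mem_coordinateIncidence_iff]
    intro k
    obtain ⟨h1, h2⟩ := hP k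
    refine ⟨(hMk _ k).trans h1, ?_⟩
    refine (hdot _ _).trans ?_
    change _ ⬝ᵥ Mᵀ *ᵥ ((Mᵀ)⁻¹ *ᵥ (P none).rep) = 0
    rwa [(hinv _ hdet' _).2]
  · obtain ⟨c, hc, h⟩ := exists_rep_point_eq _ h0
    intro k
    obtain ⟨h1, h2⟩ := hQ k
    rw [h, h, smul_dotProduct, smul_dotProduct, dotProduct_smul]
    simp only [Option.elim_some, Option.elim_none]
    rw [← hMk, ← hdot, (hinv _ hdet _).2, h1, h2]
    simp

/-- The line through the `i`-th coordinate point with given other two coordinates. -/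
def lineThrough {R : Type*} [Zero R] (i : Fin 3) (a : Fin 2 → R) : Fin 3 → R :=
  (![![0, a 0, a 1], ![a 1, 0, a 0], ![a 0, a 1, 0]] : Fin 3 → Fin 3 → R) i

/-- The two coordinates of a line through the `i`-th coordinate point. -/
def pencilCoordinates {R : Type*} (i : Fin 3) (l : Fin 3 → R) : Fin 2 → R :=
  (![![l 1, l 2], ![l 2, l 0], ![l 0, l 1]] : Fin 3 → Fin 2 → R) i

theorem pencilCoordinates_lineThrough {R : Type*} [Zero R] (i : Fin 3) (a : Fin 2 → R) :
    pencilCoordinates i (lineThrough i a) = a := by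
  funext k
  fin_cases i <;> fin_cases k <;> rfl

theorem lineThrough_pencilCoordinates {i : Fin 3} {l : Fin 3 → ℂ} (h : l i = 0) :
    lineThrough i (pencilCoordinates i l) = l := by
  funext k
  fin_cases i <;> fin_cases k <;> first | rfl | exact h.symm

theorem lineThrough_self {R : Type*} [Zero R] (i : Fin 3) (a : Fin 2 → R) :
    lineThrough i a i = 0 := by
  fin_cases i <;> rfl

theorem lineThrough_smul (i : Fin 3) (c : ℂ) (a : Fin 2 → ℂ) :
    lineThrough i (c • a) = c • lineThrough i a := by
  funext k
  fin_cases i <;> fin_cases k <;> simp [lineThrough]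

theorem pencilCoordinates_smul (i : Fin 3) (c : ℂ) (l : Fin 3 → ℂ) :
    pencilCoordinates i (c • l) = c • pencilCoordinates i l := by
  funext k
  fin_cases i <;> fin_cases k <;> simp [pencilCoordinates]

theorem pencilCoordinates_ne_zero {i : Fin 3} {l : Fin 3 → ℂ} (h : l i = 0) (hl : l ≠ 0) :
    pencilCoordinates i l ≠ 0 := by
  intro h0
  refine hl ?_
  have := lineThrough_smul i 0 0
  rw [zero_smul, zero_smul] at this
  rw [← lineThrough_pencilCoordinates h, h0, this]

theorem lineThrough_ne_zero (i : Fin 3) {a : Fin 2 → ℂ} (ha : a ≠ 0) : lineThrough i a ≠ 0 := by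
  intro h
  refine ha ?_
  have := pencilCoordinates_smul i 0 0
  rw [zero_smul, zero_smul] at this
  rw [← pencilCoordinates_lineThrough i a, h, this]

/-- The polynomials that give the line corresponding to a point of the `i`-th factor. -/
def linePoly (i : Fin 3) : Fin 3 → CoordRing (fun _ : Fin 3 => Fin 2) :=
  lineThrough i fun k => MvPolynomial.X ⟨i, k⟩

theorem isMultihomogeneous_linePoly (i k : Fin 3) :
    IsMultihomogeneous (linePoly i k) (Finsupp.single i 1) := by
  have h0 : IsMultihomogeneous (0 : CoordRing (fun _ : Fin 3 => Fin 2)) (Finsupp.single i 1) :=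
    MvPolynomial.isWeightedHomogeneous_zero ℂ _ _
  have h1 := isMultihomogeneous_X (σ := fun _ : Fin 3 => Fin 2) i
  fin_cases i <;> fin_cases k <;> first | exact h0 | exact h1 _

theorem eval_linePoly (i k : Fin 3) (v : (Σ _ : Fin 3, Fin 2) → ℂ) :
    MvPolynomial.eval v (linePoly i k) = lineThrough i (fun m => v ⟨i, m⟩) k := by
  fin_cases i <;> fin_cases k <;> simp [linePoly, lineThrough]

/-- The polynomials that give the intersection point of two lines. -/
def meetPoly (i j : Fin 3) : Fin 3 → CoordRing (fun _ : Fin 3 => Fin 2) :=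
  crossProduct (linePoly i) (linePoly j)

theorem isMultihomogeneous_meetPoly (i j k : Fin 3) :
    IsMultihomogeneous (meetPoly i j k) (Finsupp.single i 1 + Finsupp.single j 1) := by
  have h : ∀ m n, IsMultihomogeneous (linePoly i m * linePoly j n)
      (Finsupp.single i 1 + Finsupp.single j 1) := fun m n =>
    (isMultihomogeneous_linePoly i m).mul (isMultihomogeneous_linePoly j n)
  have h2 : ∀ m n m' n', IsMultihomogeneous
      (linePoly i m * linePoly j n - linePoly i m' * linePoly j n')
      (Finsupp.single i 1 + Finsupp.single j 1) := fun m n m' n' => (h m n).sub (h m' n')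
  rw [meetPoly, cross_apply]
  fin_cases k
  · exact h2 1 2 2 1
  · exact h2 2 0 0 2
  · exact h2 0 1 1 0

theorem evalRep_meetPoly (i j k : Fin 3) (q : MultiProj (fun _ : Fin 3 => Fin 2)) :
    evalRep q (meetPoly i j k) =
      crossProduct (lineThrough i (q i).rep) (lineThrough j (q j).rep) k := by
  rw [meetPoly, cross_apply, cross_apply, evalRep]
  fin_cases k <;> simp [eval_linePoly]

/-- Two distinct lines through `x` meet only there. In cross-multiplied form this survives when the
lines coincide, as needed for a formula valid on the whole surface. -/
theorem crossProduct_mul_comm {l l' x : Fin 3 → ℂ} (h : l ⬝ᵥ x = 0) (h' : l' ⬝ᵥ x = 0)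
    (m n : Fin 3) : crossProduct l l' m * x n = crossProduct l l' n * x m := by
  simp only [dotProduct, Fin.sum_univ_three] at h h'
  rw [cross_apply]
  fin_cases m <;> fin_cases n <;> simp
  · linear_combination l' 2 * h - l 2 * h'
  · linear_combination l 1 * h' - l' 1 * h
  · linear_combination l 2 * h' - l' 2 * h
  · linear_combination l' 0 * h - l 0 * h'
  · linear_combination l' 1 * h - l 1 * h'
  · linear_combination l 0 * h' - l' 0 * h

/-- The relation between the lines joining a point to the three coordinate points. -/
theorem hexagon_of_concurrent {v : Fin 3 → Fin 2 → ℂ} {x : Fin 3 → ℂ} (hx : x ≠ 0)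
    (h : ∀ i, lineThrough i (v i) ⬝ᵥ x = 0) :
    v 0 0 * v 1 0 * v 2 0 + v 0 1 * v 1 1 * v 2 1 = 0 := by
  have h0 := h 0
  have h1 := h 1
  have h2 := h 2
  simp [lineThrough, dotProduct, Fin.sum_univ_three] at h0 h1 h2
  obtain ⟨k, hk⟩ := Function.ne_iff.mp hx
  -- The expression is the determinant of the three lines; by Cramer's rule its product with each
  -- coordinate of `x` is a combination of the three incidences.
  refine (mul_eq_zero.mp ?_).resolve_right hk
  fin_cases k
  · change _ * x 0 = 0
    linear_combination v 0 0 * v 1 0 * h2 - v 1 0 * v 2 1 * h0 + v 0 1 * v 2 1 * h1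
  · change _ * x 1 = 0
    linear_combination v 1 0 * v 2 0 * h0 - v 2 0 * v 0 1 * h1 + v 1 1 * v 0 1 * h2
  · change _ * x 2 = 0
    linear_combination v 0 0 * v 2 0 * h1 - v 0 0 * v 1 1 * h2 + v 1 1 * v 2 1 * h0

/-- Three lines through the coordinate points that satisfy the relation are concurrent, and two
of them are distinct. -/
theorem exists_concurrent {v : Fin 3 → Fin 2 → ℂ} (hv : ∀ i, v i ≠ 0)
    (h : v 0 0 * v 1 0 * v 2 0 + v 0 1 * v 1 1 * v 2 1 = 0) :
    ∃ i j, crossProduct (lineThrough i (v i)) (lineThrough j (v j)) ≠ 0 ∧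
      ∀ k, lineThrough k (v k) ⬝ᵥ
        crossProduct (lineThrough i (v i)) (lineThrough j (v j)) = 0 := by
  -- In each chart the product of the two nonzero entries is, up to sign, a component of the cross
  -- product. Incidence with the third line is the vanishing of the determinant.
  rcases exists_ne_zero_of_hexagon hv h with ⟨h0, h1⟩ | ⟨h0, h1⟩ | ⟨h0, h1⟩
  · refine ⟨0, 1, Function.ne_iff.mpr ⟨2, ?_⟩, fun k => ?_⟩
    · simp [cross_apply, lineThrough, h0, h1]
    · fin_cases k <;> simp [cross_apply, lineThrough, dotProduct, Fin.sum_univ_three]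
      all_goals first | ring1 | linear_combination h
  · refine ⟨1, 2, Function.ne_iff.mpr ⟨0, ?_⟩, fun k => ?_⟩
    · simp [cross_apply, lineThrough, h0, h1]
    · fin_cases k <;> simp [cross_apply, lineThrough, dotProduct, Fin.sum_univ_three]
      all_goals first | ring1 | linear_combination h
  · refine ⟨2, 0, Function.ne_iff.mpr ⟨1, ?_⟩, fun k => ?_⟩
    · simp [cross_apply, lineThrough, h0, h1]
    · fin_cases k <;> simp [cross_apply, lineThrough, dotProduct, Fin.sum_univ_three]
      all_goals first | ring1 | linear_combination h

theorem lineThrough_pencilCoordinates_rep (P : coordinateIncidence) (i : Fin 3) :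
    lineThrough i (pencilCoordinates i (P.1 (some i)).rep) = (P.1 (some i)).rep :=
  lineThrough_pencilCoordinates (P.2 i).1

theorem pencilCoordinates_rep_ne_zero (P : coordinateIncidence) (i : Fin 3) :
    pencilCoordinates i (P.1 (some i)).rep ≠ 0 :=
  pencilCoordinates_ne_zero (P.2 i).1 (P.1 (some i)).rep_nonzero

theorem point_pencilCoordinates_mem (P : coordinateIncidence) :
    point (fun i => pencilCoordinates i (P.1 (some i)).rep) (pencilCoordinates_rep_ne_zero P) ∈
      hexagonSurface := by
  rw [point_mem_hexagonSurface_iff]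
  refine hexagon_of_concurrent (v := fun i => pencilCoordinates i (P.1 (some i)).rep)
    (P.1 none).rep_nonzero fun i => ?_
  rw [lineThrough_pencilCoordinates_rep]
  exact (P.2 i).2

/-- The map that forgets the point of the plane and keeps the three lines. -/
def pencilMap (P : coordinateIncidence) : hexagonSurface :=
  ⟨_, point_pencilCoordinates_mem P⟩

theorem exists_lineThrough_pencilMap (P : coordinateIncidence) :
    ∃ c : Fin 3 → ℂ, ∀ i, lineThrough i ((pencilMap P).1 i).rep = c i • (P.1 (some i)).rep := by
  obtain ⟨c, -, h⟩ := exists_rep_point_eq _ (pencilCoordinates_rep_ne_zero P)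
  refine ⟨c, fun i => ?_⟩
  rw [← lineThrough_pencilCoordinates_rep P i, ← lineThrough_smul, ← h i]
  rfl

theorem isRegularMap_pencilMap : IsRegularMap pencilMap := by
  refine isRegularMap_iff.mpr fun P i => ?_
  let G : Fin 2 → CoordRing (fun _ : Option (Fin 3) => Fin 3) :=
    pencilCoordinates i fun m => MvPolynomial.X ⟨some i, m⟩
  have hG : ∀ k, IsMultihomogeneous (G k) (Finsupp.single (some i) 1) := by
    intro k
    have h1 := isMultihomogeneous_X (σ := fun _ : Option (Fin 3) => Fin 3) (some i)
    fin_cases i <;> fin_cases k <;> exact h1 _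
  have hev : ∀ (Q : MultiProj (fun _ : Option (Fin 3) => Fin 3)) k,
      evalRep Q (G k) = pencilCoordinates i (Q (some i)).rep k := by
    intro Q k
    fin_cases i <;> fin_cases k <;> simp [G, pencilCoordinates, evalRep]
  refine ⟨_, G, hG, ?_, fun Q k l => ?_⟩
  · obtain ⟨k, hk⟩ := Function.ne_iff.mp (pencilCoordinates_rep_ne_zero P i)
    exact ⟨k, by rw [hev]; exact hk⟩
  · rw [hev, hev]
    exact mul_rep_mk_comm _ (pencilCoordinates_rep_ne_zero Q i) k l

theorem pencilMap_surjective : Function.Surjective pencilMap := by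
  rintro ⟨q, hq⟩
  obtain ⟨i, j, hij, hconc⟩ := exists_concurrent (v := fun i => (q i).rep)
    (fun i => (q i).rep_nonzero) hq
  let w : Option (Fin 3) → Fin 3 → ℂ := fun o =>
    o.elim (crossProduct (lineThrough i (q i).rep) (lineThrough j (q j).rep))
      fun k => lineThrough k (q k).rep
  have hw : ∀ o, w o ≠ 0 := by
    intro o
    cases o with
    | none => exact hij
    | some k => exact lineThrough_ne_zero k (q k).rep_nonzero
  obtain ⟨c, hc, h⟩ := exists_rep_point_eq w hw
  refine ⟨⟨point w hw, (point_mem_coordinateIncidence_iff w hw).mpr fun k =>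
    ⟨lineThrough_self _ _, hconc k⟩⟩, Subtype.ext (funext fun k => ?_)⟩
  refine Eq.trans ?_ (q k).mk_rep
  refine (Projectivization.mk_eq_mk_iff' ℂ _ _ _ _).mpr ⟨c (some k), ?_⟩
  change _ = pencilCoordinates k (point w hw (some k)).rep
  rw [h (some k), pencilCoordinates_smul]
  exact congrArg (c (some k) • ·) (pencilCoordinates_lineThrough _ _).symm

/-- Near each point the plane component of the inverse is the intersection of two lines that are
distinct there, given by `meetPoly`. -/
theorem areIsomorphic_coordinateIncidence_hexagonSurface :
    AreIsomorphic coordinateIncidence hexagonSurface := by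
  refine areIsomorphic_of_surjective pencilMap isRegularMap_pencilMap pencilMap_surjective
    fun P i => ?_
  cases i with
  | none =>
    obtain ⟨i, j, hij, -⟩ := exists_concurrent (v := fun i => ((pencilMap P).1 i).rep)
      (fun i => ((pencilMap P).1 i).rep_nonzero) (pencilMap P).2
    obtain ⟨k, hk⟩ := Function.ne_iff.mp hij
    refine ⟨_, meetPoly i j, isMultihomogeneous_meetPoly i j, ⟨k, ?_⟩, fun Q m n => ?_⟩
    · rw [evalRep_meetPoly]
      exact hk
    · obtain ⟨c, h⟩ := exists_lineThrough_pencilMap Q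
      rw [evalRep_meetPoly, evalRep_meetPoly]
      refine crossProduct_mul_comm ?_ ?_ m n
      · rw [h, smul_dotProduct, (Q.2 i).2, smul_zero]
      · rw [h, smul_dotProduct, (Q.2 j).2, smul_zero]
  | some i =>
    have hev : ∀ (Q : coordinateIncidence) k,
        evalRep (pencilMap Q).1 (linePoly i k) = lineThrough i ((pencilMap Q).1 i).rep k :=
      fun Q k => eval_linePoly i k _
    refine ⟨_, linePoly i, isMultihomogeneous_linePoly i, ?_, fun Q m n => ?_⟩
    · obtain ⟨k, hk⟩ := Function.ne_iff.mp
        (lineThrough_ne_zero i ((pencilMap P).1 i).rep_nonzero)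
      exact ⟨k, by rw [hev]; exact hk⟩
    · obtain ⟨c, h⟩ := exists_lineThrough_pencilMap Q
      rw [hev, hev, h, Pi.smul_apply, Pi.smul_apply, smul_eq_mul, smul_eq_mul]
      ring

theorem areIsomorphic_blowUpPlane_hexagonSurface {p : Fin 3 → ℙ ℂ (Fin 3 → ℂ)}
    (hp : Projectivization.Independent p) : AreIsomorphic (blowUpPlane p) hexagonSurface := by
  have hinj : Function.Injective p :=
    Function.Injective.of_comp (Projectivization.independent_iff.mp hp).injective
  rw [blowUpPlane_eq_incidence hinj]
  exact (areIsomorphic_incidence_coordinateIncidence hp).trans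
    areIsomorphic_coordinateIncidence_hexagonSurface

end Hexagon

end

end Togliatti

theorem mainTheorem7 :
    (∃ U : Set (Togliatti.ProjSpace (Fin 3 → Fin 2)),
      Togliatti.IsZariskiOpen U ∧ U.Nonempty ∧
      ∀ a ∈ U, Togliatti.IsTransverseToSeg 3 a ∧
        Togliatti.AreIsomorphic (Togliatti.hyperplane a ∩ Togliatti.Seg 3)
          Togliatti.togliattiSurface) ∧
    (∀ p : Fin 3 → Projectivization ℂ (Fin 3 → ℂ), Projectivization.Independent p →
      Togliatti.AreIsomorphic Togliatti.togliattiSurface (Togliatti.blowUpPlane p)) := by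
  refine ⟨⟨Togliatti.generalHyperplanes, Togliatti.isZariskiOpen_generalHyperplanes,
    Togliatti.generalHyperplanes_nonempty, fun a ha => ?_⟩, fun p hp => ?_⟩
  · obtain ⟨u, v, h⟩ := Togliatti.exists_isGeneralSum ha.1 ha.2
    exact ⟨h.isTransverseToSeg, (Togliatti.areIsomorphic_hyperplane_inter_Seg h).trans
      Togliatti.areIsomorphic_togliattiSurface_hexagonSurface.symm⟩
  · exact Togliatti.areIsomorphic_togliattiSurface_hexagonSurface.trans
      (Togliatti.areIsomorphic_blowUpPlane_hexagonSurface hp).symm
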